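/- Let $k$ be a field of characteristic $0$ and let $H$ be a Hopf algebra over $k$ with bijective antipode $S$; write $\Delta(h)=h^1\otimes h^2$, $(\Delta\otimes\mathrm{Id})\Delta(h)=h^1\otimes h^2\otimes h^3$, and $\rho(m)=m_0\otimes m_1$ for a right coaction. Let $i\in\mathbb{Z}$. For $j\in\mathbb{Z}$, a $YD_j$-module is a $k$-vector space $M$ that is a left $H$-module and a right $H$-comodule such that $$(hm)_0\otimes(hm)_1=h^2m_0\otimes h^3m_1S^{-1-2j}(h^1)\qquad(h\in H,\ m\in M).$$ A right $H$-contramodule is a $k$-vector space $N$ with a linear map $\alpha:\mathrm{Hom}(H,N)\to N$ such that $\alpha(x\mapsto\alpha(h\mapsto f(x\otimes h)))=\alpha(h\mapsto f(h^1\otimes h^2))$ for all $f\in\mathrm{Hom}(H\otimes H,N)$ and $\alpha(h\mapsto\epsilon(h)n)=n$ for all $n\in N$. A $YD_j$-contramodule is a left $H$-module and right $H$-contramodule $N$ such that $$h\,\alpha(f)=\alpha\bigl(x\mapsto h^2f(S(h^3)\,x\,S^{2-2j}(h^1))\bigr)\qquad(h\in H,\ f\in\mathrm{Hom}(H,N)).$$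 Morphisms in the categories $YD_j\text{-mod}$ and $YD_j\text{-ctrmd}$ are the linear maps compatible with both structures. 1. Let $M$ be a $YD_{i-1}$-module and let $\widehat{M}=\mathrm{Hom}(H,M)^H$ be the space of right $H$-comodule maps $H\to M$, where $H$ has the coaction $\Delta$. Then $$(h\cdot f)(x)=h^2f\bigl(S(h^3)\,x\,S^{-2i}(h^1)\bigr),\qquad (\alpha\theta)(h)=\theta_{h^1}(h^2)\quad(\theta\in\mathrm{Hom}(H,\widehat{M}))$$ are well defined on $\widehat{M}$ and make it a $YD_{i+1}$-contramodule. 2. Let $N$ be a $YD_{i+1}$-contramodule and let $N'=H\odot_H N$ be the cokernel of the difference of the two maps $H\otimes\mathrm{Hom}(H,N)\to H\otimes N$ given by $h\otimes f\mapsto h\otimes\alpha(f)$ and $h\otimes f\mapsto h^2\otimes f(h^1)$. Then $$h\cdot(x\otimes n)=h^3\,x\,S^{1-2i}(h^1)\otimes h^2n,\qquad \rho(h\otimes n)=(h^1\otimes n)\otimes h^2$$ are well defined on $N'$ and make it a $YD_{i-1}$-module. 3. With $\widehat{g}(\varphi)=g\circ\varphi$ and $g'(h\otimes n)=h\otimes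 g(n)$ on morphisms, these constructions are functors $\widehat{(-)}_H:YD_{i-1}\text{-mod}\to YD_{i+1}\text{-ctrmd}$ and $(-)'_H:YD_{i+1}\text{-ctrmd}\to YD_{i-1}\text{-mod}$, and $(-)'_H$ is left adjoint to $\widehat{(-)}_H$. -/

import Mathlib

open CategoryTheory
open scoped TensorProduct

universe u v w

namespace HopfYD

/-- The antipode of the Hopf algebra `H` over `k` is bijective. -/
class BijectiveAntipode (k : Type u) (H : Type v) [Field k] [Ring H] [HopfAlgebra k H] :
    Prop where
  bijective : Function.Bijective (HopfAlgebra.antipode k : H →ₗ[k] H)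

section Structures

variable (k : Type u) (H : Type v) [Field k] [Ring H] [HopfAlgebra k H]

/-- The antipode as a linear automorphism, so that `antipodeEquiv k H ^ n` is `S^n`, `n : ℤ`. -/
noncomputable def antipodeEquiv [BijectiveAntipode k H] : H ≃ₗ[k] H :=
  LinearEquiv.ofBijective (HopfAlgebra.antipode k : H →ₗ[k] H) BijectiveAntipode.bijective

/-- The power `S^n` of the antipode, `n : ℤ`, as a linear map. -/
noncomputable def antipodePow [BijectiveAntipode k H] (n : ℤ) : H →ₗ[k] H :=
  ((antipodeEquiv k H ^ n : H ≃ₗ[k] H) : H →ₗ[k] H)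

/-- `sandwich k H b a` is the linear map `x ↦ a * x * b`. -/
noncomputable def sandwich : H →ₗ[k] H →ₗ[k] Module.End k H :=
  LinearMap.mk₂ k (fun b a => LinearMap.mulRight k b ∘ₗ LinearMap.mulLeft k a)
    (by intros; ext; simp [mul_add]) (by intros; ext; simp)
    (by intros; ext; simp [add_mul]) (by intros; ext; simp)

/-- Sweedler notation: `sweedler₃ k H T h = ∑ T h¹ h² h³` for a trilinear map `T`. -/
noncomputable def sweedler₃ {P : Type w} [AddCommMonoid P] [Module k P]
    (T : H →ₗ[k] H →ₗ[k] H →ₗ[k] P) : H →ₗ[k] P :=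
  TensorProduct.lift ((TensorProduct.lift.equiv (RingHom.id k) H H P).toLinearMap ∘ₗ T) ∘ₗ
    LinearMap.lTensor H (Coalgebra.comul (R := k) (A := H)) ∘ₗ Coalgebra.comul

/-- For a bilinear `Φ`, an action `act` and linear maps `σ τ : H → H`,
the map `h ↦ ∑ Φ (act h²) (x ↦ σ(h³) x τ(h¹))`. -/
noncomputable def twist {M P : Type*} [AddCommGroup M] [Module k M] [AddCommMonoid P] [Module k P]
    (Φ : Module.End k M →ₗ[k] Module.End k H →ₗ[k] P)
    (act : H →ₐ[k] Module.End k M) (σ τ : H →ₗ[k] H) : H →ₗ[k] P :=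
  sweedler₃ k H (LinearMap.mk₂ k (fun h₁ h₂ => Φ (act h₂) ∘ₗ sandwich k H (τ h₁) ∘ₗ σ)
    (by intros; ext; simp) (by intros; ext; simp)
    (by intros; ext; simp) (by intros; ext; simp))

/-- The bilinear map sending `a : M → M` and `b : H → H` to `f ↦ a ∘ f ∘ b` on `Hom(H, M)`. -/
noncomputable def conjHom (M : Type*) [AddCommGroup M] [Module k M] :
    Module.End k M →ₗ[k] Module.End k H →ₗ[k] Module.End k (H →ₗ[k] M) :=
  LinearMap.mk₂ k (fun a b => LinearMap.lcomp k M b ∘ₗ LinearMap.compRight k a)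
    (by intros; ext; simp) (by intros; ext; simp)
    (by intros; ext; simp) (by intros; ext; simp)

/-- The bilinear map sending `a : M → M` and `b : H → H` to `b ⊗ a` on `H ⊗ M`. -/
noncomputable def endMapHM (M : Type*) [AddCommGroup M] [Module k M] :
    Module.End k M →ₗ[k] Module.End k H →ₗ[k] Module.End k (H ⊗[k] M) :=
  LinearMap.mk₂ k (fun a b => TensorProduct.map b a)
    (by intros; ext; simp [TensorProduct.tmul_add]) (by intros; ext; simp)
    (by intros; ext; simp [TensorProduct.add_tmul])
    (by intros; ext; simp [TensorProduct.smul_tmul'])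

/-- A right comodule over the coalgebra `H`: `ρ(m) = m₀ ⊗ m₁`. -/
@[ext]
structure RightComodule (M : Type w) [AddCommGroup M] [Module k M] where
  coact : M →ₗ[k] M ⊗[k] H
  coassoc : ∀ m, TensorProduct.assoc k M H H (coact.rTensor H (coact m)) =
    (Coalgebra.comul (R := k) (A := H)).lTensor M (coact m)
  counit_coact : ∀ m, TensorProduct.rid k M
    ((Coalgebra.counit (R := k) (A := H)).lTensor M (coact m)) = m

/-- A right contramodule over the coalgebra `H`, with contraaction `α : Hom(H, N) → N`:
`α(x ↦ α(h ↦ f(x ⊗ h))) = α(h ↦ f(h¹ ⊗ h²))` and `α(h ↦ ε(h) n) = n`. -/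
@[ext]
structure RightContramodule (N : Type w) [AddCommGroup N] [Module k N] where
  contra : (H →ₗ[k] N) →ₗ[k] N
  contra_assoc : ∀ f : H ⊗[k] H →ₗ[k] N,
    contra (contra ∘ₗ TensorProduct.curry f) = contra (f ∘ₗ Coalgebra.comul)
  contra_counit : ∀ n : N, contra ((Coalgebra.counit (R := k) (A := H)).smulRight n) = n

variable {k H}

/-- `h · (m ⊗ x) = ∑ h² m ⊗ h³ x S^n(h¹)` on `M ⊗ H`. -/
noncomputable def twistMH [BijectiveAntipode k H] {M : Type w} [AddCommGroup M] [Module k M]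
    (act : H →ₐ[k] Module.End k M) (n : ℤ) : H →ₗ[k] Module.End k (M ⊗[k] H) :=
  twist k H (TensorProduct.mapBilinear (RingHom.id k) M H M H) act LinearMap.id (antipodePow k H n)

/-- `h · (x ⊗ m) = ∑ h³ x S^n(h¹) ⊗ h² m` on `H ⊗ M`. -/
noncomputable def twistHM [BijectiveAntipode k H] {M : Type w} [AddCommGroup M] [Module k M]
    (act : H →ₐ[k] Module.End k M) (n : ℤ) : H →ₗ[k] Module.End k (H ⊗[k] M) :=
  twist k H (endMapHM k H M) act LinearMap.id (antipodePow k H n)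

/-- `h · f = ∑ h² f(S(h³) - S^n(h¹))` on `Hom(H, M)`. -/
noncomputable def twistHom [BijectiveAntipode k H] {M : Type w} [AddCommGroup M] [Module k M]
    (act : H →ₐ[k] Module.End k M) (n : ℤ) : H →ₗ[k] Module.End k (H →ₗ[k] M) :=
  twist k H (conjHom k H M) act (HopfAlgebra.antipode k) (antipodePow k H n)

variable (k H)

/-- A `YD_i`-module structure on the vector space `M`: a left `H`-module and right `H`-comodule with
`(hm)₀ ⊗ (hm)₁ = h² m₀ ⊗ h³ m₁ S^{-1-2i}(h¹)`. -/
@[ext]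
structure YDModule [BijectiveAntipode k H] (i : ℤ) (M : Type w) [AddCommGroup M] [Module k M]
    extends RightComodule k H M where
  act : H →ₐ[k] Module.End k M
  coact_act : ∀ (h : H) (m : M), coact (act h m) = twistMH act (-1 - 2 * i) h (coact m)

/-- A `YD_i`-contramodule structure on the vector space `N`: a left `H`-module and right
`H`-contramodule with `h α(f) = α(h² f(S(h³) - S^{2-2i}(h¹)))`. -/
@[ext]
structure YDContramodule [BijectiveAntipode k H] (i : ℤ) (N : Type w) [AddCommGroup N] [Module k N]
    extends RightContramodule k H N where
  act : H →ₐ[k] Module.End k N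
  contra_act : ∀ (h : H) (f : H →ₗ[k] N),
    contra (twistHom act (2 - 2 * i) h f) = act h (contra f)

/-- The category `YD_i`-mod. -/
structure YDModCat [BijectiveAntipode k H] (i : ℤ) where
  carrier : Type w
  [addCommGroup : AddCommGroup carrier]
  [module : Module k carrier]
  str : YDModule k H i carrier

/-- The category `YD_i`-ctrmd. -/
structure YDContraCat [BijectiveAntipode k H] (i : ℤ) where
  carrier : Type w
  [addCommGroup : AddCommGroup carrier]
  [module : Module k carrier]
  str : YDContramodule k H i carrier

attribute [instance] YDModCat.addCommGroup YDModCat.module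
attribute [instance] YDContraCat.addCommGroup YDContraCat.module

end Structures

section Categories

variable {k : Type u} {H : Type v} [Field k] [Ring H] [HopfAlgebra k H] [BijectiveAntipode k H]
  {i : ℤ}

/-- A morphism of `YD_i`-modules: a linear map that is `H`-linear and `H`-colinear. -/
@[ext]
structure YDModCat.Hom (M M' : YDModCat.{u, v, w} k H i) where
  hom : M.carrier →ₗ[k] M'.carrier
  map_act : ∀ h m, hom (M.str.act h m) = M'.str.act h (hom m)
  map_coact : ∀ m, M'.str.coact (hom m) = hom.rTensor H (M.str.coact m)

/-- A morphism of `YD_i`-contramodules: an `H`-linear map commuting with the contraactions. -/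
@[ext]
structure YDContraCat.Hom (N N' : YDContraCat.{u, v, w} k H i) where
  hom : N.carrier →ₗ[k] N'.carrier
  map_act : ∀ h n, hom (N.str.act h n) = N'.str.act h (hom n)
  map_contra : ∀ f : H →ₗ[k] N.carrier, hom (N.str.contra f) = N'.str.contra (hom ∘ₗ f)

instance : Category (YDModCat.{u, v, w} k H i) where
  Hom M M' := YDModCat.Hom M M'
  id M := ⟨LinearMap.id, by simp, by simp⟩
  comp f g := ⟨g.hom ∘ₗ f.hom, by simp [f.map_act, g.map_act],
    by simp [f.map_coact, g.map_coact, LinearMap.rTensor_comp]⟩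

instance : Category (YDContraCat.{u, v, w} k H i) where
  Hom N N' := YDContraCat.Hom N N'
  id N := ⟨LinearMap.id, by simp, by simp⟩
  comp f g := ⟨g.hom ∘ₗ f.hom, by simp [f.map_act, g.map_act],
    by simp [f.map_contra, g.map_contra, LinearMap.comp_assoc]⟩

end Categories

section HatAndPrime

variable {k : Type u} {H : Type v} [Field k] [Ring H] [HopfAlgebra k H]

/-- `M̂ = Hom(H, M)^H`, the space of `H`-comodule maps from `H` (with coaction `Δ`) to `M`. -/
def hat {M : Type w} [AddCommGroup M] [Module k M] (C : RightComodule k H M) :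
    Submodule k (H →ₗ[k] M) where
  carrier := {φ | ∀ h, C.coact (φ h) = φ.rTensor H (Coalgebra.comul h)}
  add_mem' := by
    intro a b ha hb h
    simp only [Set.mem_ofPred_eq] at ha hb
    simp [ha, hb, LinearMap.rTensor_add]
  zero_mem' := by intro h; simp
  smul_mem' := by
    intro c a ha h
    simp only [Set.mem_ofPred_eq] at ha
    simp [ha, LinearMap.rTensor_smul]

/-- For `θ : H → M̂`, the map `h ↦ ∑ θ_{h¹}(h²)`. -/
noncomputable def hatContra {M : Type w} [AddCommGroup M] [Module k M] (C : RightComodule k H M)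
    (θ : H →ₗ[k] hat C) : H →ₗ[k] M :=
  TensorProduct.lift ((hat C).subtype ∘ₗ θ) ∘ₗ Coalgebra.comul

/-- The map `φ ↦ g ∘ φ` from `M̂` to `M̂'`, for `g : M → M'` a map of comodules. -/
def hatMap {M M' : Type w} [AddCommGroup M] [Module k M] [AddCommGroup M'] [Module k M']
    {C : RightComodule k H M} {C' : RightComodule k H M'} (g : M →ₗ[k] M')
    (hg : ∀ m, C'.coact (g m) = g.rTensor H (C.coact m)) : hat C →ₗ[k] hat C' :=
  (LinearMap.compRight k g).restrict (by
    intro φ hφ h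
    have := hφ h
    simp [hg, this, LinearMap.rTensor_comp])

theorem coe_hatMap {M M' : Type w} [AddCommGroup M] [Module k M] [AddCommGroup M'] [Module k M']
    {C : RightComodule k H M} {C' : RightComodule k H M'} (g : M →ₗ[k] M')
    (hg : ∀ m, C'.coact (g m) = g.rTensor H (C.coact m)) (φ : hat C) :
    (hatMap g hg φ : H →ₗ[k] M') = g ∘ₗ (φ : H →ₗ[k] M) := rfl

/-- The map `H ⊗ Hom(H, N) → H ⊗ N`, `h ⊗ f ↦ ∑ h² ⊗ f(h¹)`. -/
noncomputable def evalMap (k : Type u) (H : Type v) [Field k] [Ring H] [HopfAlgebra k H]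
    (N : Type w) [AddCommGroup N] [Module k N] : H ⊗[k] (H →ₗ[k] N) →ₗ[k] H ⊗[k] N :=
  TensorProduct.lift (LinearMap.mk₂ k
    (fun h f => TensorProduct.comm k N H (f.rTensor H (Coalgebra.comul h)))
    (by intros; simp) (by intros; simp)
    (by intros; simp [LinearMap.rTensor_add]) (by intros; simp [LinearMap.rTensor_smul]))

/-- `N' = H ⊙_H N`, the cokernel of the difference of `Id ⊗ α` and `h ⊗ f ↦ h² ⊗ f(h¹)`. -/
abbrev Prime {N : Type w} [AddCommGroup N] [Module k N] (C : RightContramodule k H N) : Type _ :=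
  (H ⊗[k] N) ⧸ LinearMap.range (C.contra.lTensor H - evalMap k H N)

/-- The projection `H ⊗ N → N'`. -/
noncomputable def primeMk {N : Type w} [AddCommGroup N] [Module k N]
    (C : RightContramodule k H N) : H ⊗[k] N →ₗ[k] Prime C :=
  Submodule.mkQ _

theorem primeMk_surjective {N : Type w} [AddCommGroup N] [Module k N]
    (C : RightContramodule k H N) : Function.Surjective (primeMk C) :=
  Submodule.mkQ_surjective _

/-- The map `h ⊗ n ↦ h ⊗ g(n)` from `N'` to `N₁'`, for `g : N → N₁` a map of contramodules. -/
noncomputable def primeMap {N N₁ : Type w} [AddCommGroup N] [Module k N] [AddCommGroup N₁]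
    [Module k N₁] {C : RightContramodule k H N} {C₁ : RightContramodule k H N₁} (g : N →ₗ[k] N₁)
    (hg : ∀ f : H →ₗ[k] N, g (C.contra f) = C₁.contra (g ∘ₗ f)) : Prime C →ₗ[k] Prime C₁ :=
  Submodule.mapQ _ _ (g.lTensor H) (by
    rintro _ ⟨x, rfl⟩
    refine ⟨(LinearMap.compRight k g).lTensor H x, ?_⟩
    induction x with
    | zero => simp
    | add x y hx hy => simp only [map_add, hx, hy]
    | tmul h f =>
      simp only [LinearMap.sub_apply, LinearMap.lTensor_tmul, map_sub, evalMap,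
        LinearMap.compRight_apply, hg, TensorProduct.lift.tmul, LinearMap.mk₂_apply]
      congr 1
      generalize Coalgebra.comul (R := k) h = z
      induction z with
      | zero => simp
      | add x y hx hy => simp only [map_add, hx, hy]
      | tmul x y => simp)

theorem primeMap_mk {N N₁ : Type w} [AddCommGroup N] [Module k N] [AddCommGroup N₁]
    [Module k N₁] {C : RightContramodule k H N} {C₁ : RightContramodule k H N₁} (g : N →ₗ[k] N₁)
    (hg : ∀ f : H →ₗ[k] N, g (C.contra f) = C₁.contra (g ∘ₗ f)) (x : H ⊗[k] N) :
    primeMap g hg (primeMk C x) = primeMk C₁ (g.lTensor H x) := rfl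

/-- The map `H ⊗ N → (H ⊗ N) ⊗ H`, `h ⊗ n ↦ ∑ (h¹ ⊗ n) ⊗ h²`. -/
noncomputable def primeCoact (k : Type u) (H : Type v) [Field k] [Ring H] [HopfAlgebra k H]
    (N : Type w) [AddCommGroup N] [Module k N] : H ⊗[k] N →ₗ[k] (H ⊗[k] N) ⊗[k] H :=
  (TensorProduct.rightComm k H H N).toLinearMap ∘ₗ
    (Coalgebra.comul (R := k) (A := H)).rTensor N

theorem primeMap_id {N : Type w} [AddCommGroup N] [Module k N] (C : RightContramodule k H N) :
    primeMap (C := C) (C₁ := C) LinearMap.id (fun _ => rfl) = LinearMap.id := by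
  refine LinearMap.ext fun x => ?_
  obtain ⟨x, rfl⟩ := primeMk_surjective _ x
  rw [primeMap_mk, LinearMap.lTensor_id]
  rfl

theorem primeMap_comp {N N₁ N₂ : Type w} [AddCommGroup N] [Module k N] [AddCommGroup N₁]
    [Module k N₁] [AddCommGroup N₂] [Module k N₂] {C : RightContramodule k H N}
    {C₁ : RightContramodule k H N₁} {C₂ : RightContramodule k H N₂} (g : N →ₗ[k] N₁)
    (hg : ∀ f : H →ₗ[k] N, g (C.contra f) = C₁.contra (g ∘ₗ f)) (g₁ : N₁ →ₗ[k] N₂)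
    (hg₁ : ∀ f : H →ₗ[k] N₁, g₁ (C₁.contra f) = C₂.contra (g₁ ∘ₗ f))
    (hg₂ : ∀ f : H →ₗ[k] N, (g₁ ∘ₗ g) (C.contra f) = C₂.contra ((g₁ ∘ₗ g) ∘ₗ f)) :
    primeMap (g₁ ∘ₗ g) hg₂ = primeMap g₁ hg₁ ∘ₗ primeMap g hg := by
  refine LinearMap.ext fun x => ?_
  obtain ⟨x, rfl⟩ := primeMk_surjective _ x
  rw [LinearMap.comp_apply, primeMap_mk, primeMap_mk, primeMap_mk, LinearMap.lTensor_comp]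
  rfl

theorem primeMap_coact {N N₁ : Type w} [AddCommGroup N] [Module k N] [AddCommGroup N₁]
    [Module k N₁] {C : RightContramodule k H N} {C₁ : RightContramodule k H N₁} (g : N →ₗ[k] N₁)
    (hg : ∀ f : H →ₗ[k] N, g (C.contra f) = C₁.contra (g ∘ₗ f)) (x : H ⊗[k] N) :
    (primeMap g hg).rTensor H ((primeMk C).rTensor H (primeCoact k H N x)) =
      (primeMk C₁).rTensor H (primeCoact k H N₁ (g.lTensor H x)) := by
  induction x with
  | zero => simp only [map_zero]
  | add x y hx hy => simp only [map_add, hx, hy]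
  | tmul x y =>
    simp only [primeCoact, LinearMap.comp_apply, LinearMap.lTensor_tmul, LinearMap.rTensor_tmul]
    generalize Coalgebra.comul (R := k) x = z
    induction z with
    | zero => simp only [map_zero, TensorProduct.zero_tmul]
    | add x y hx hy => simp only [map_add, TensorProduct.add_tmul, hx, hy]
    | tmul x z =>
      simp only [LinearEquiv.coe_coe, TensorProduct.rightComm_tmul, LinearMap.rTensor_tmul,
        primeMap_mk, LinearMap.lTensor_tmul]

end HatAndPrime

section Functors

variable {k : Type u} {H : Type v} [Field k] [Ring H] [HopfAlgebra k H]

theorem twist_congr {M M' P P' Q : Type*} [AddCommGroup M] [Module k M] [AddCommGroup M']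
    [Module k M'] [AddCommMonoid P] [Module k P] [AddCommMonoid P'] [Module k P'] [AddCommMonoid Q]
    [Module k Q] (Φ : Module.End k M →ₗ[k] Module.End k H →ₗ[k] P)
    (Φ' : Module.End k M' →ₗ[k] Module.End k H →ₗ[k] P')
    (act : H →ₐ[k] Module.End k M) (act' : H →ₐ[k] Module.End k M') (σ τ : H →ₗ[k] H)
    (L : P →ₗ[k] Q) (L' : P' →ₗ[k] Q)
    (hL : ∀ a b, L (Φ (act a) b) = L' (Φ' (act' a) b)) (h : H) :
    L (twist k H Φ act σ τ h) = L' (twist k H Φ' act' σ τ h) := by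
  simp only [twist, sweedler₃, LinearMap.comp_apply]
  generalize (LinearMap.lTensor H (Coalgebra.comul (R := k) (A := H))) (Coalgebra.comul h) = t
  induction t with
  | zero => simp
  | add x y hx hy => simp only [map_add, hx, hy]
  | tmul x y =>
    induction y with
    | zero => simp
    | add y z hy hz => simp only [TensorProduct.tmul_add, map_add, hy, hz]
    | tmul y z => simp [hL]

variable [BijectiveAntipode k H]

theorem twistHom_comp {M M' : Type w} [AddCommGroup M] [Module k M] [AddCommGroup M']
    [Module k M'] (act : H →ₐ[k] Module.End k M) (act' : H →ₐ[k] Module.End k M') (n : ℤ)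
    (g : M →ₗ[k] M') (hg : ∀ h m, g (act h m) = act' h (g m)) (h : H) (f : H →ₗ[k] M) :
    g ∘ₗ twistHom act n h f = twistHom act' n h (g ∘ₗ f) :=
  twist_congr (conjHom k H M) (conjHom k H M') act act' _ _
    (LinearMap.compRight k g ∘ₗ LinearMap.applyₗ f) (LinearMap.applyₗ (g ∘ₗ f))
    (fun a b => by ext x; simp [conjHom, hg]) h

theorem twistHM_lTensor {M M' : Type w} [AddCommGroup M] [Module k M] [AddCommGroup M']
    [Module k M'] (act : H →ₐ[k] Module.End k M) (act' : H →ₐ[k] Module.End k M') (n : ℤ)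
    (g : M →ₗ[k] M') (hg : ∀ h m, g (act h m) = act' h (g m)) (h : H) (x : H ⊗[k] M) :
    g.lTensor H (twistHM act n h x) = twistHM act' n h (g.lTensor H x) :=
  twist_congr (endMapHM k H M) (endMapHM k H M') act act' _ _
    (g.lTensor H ∘ₗ LinearMap.applyₗ x) (LinearMap.applyₗ (g.lTensor H x))
    (fun a b => by
      induction x with
      | zero => simp
      | add x y hx hy =>
        simp only [LinearMap.comp_apply, LinearMap.applyₗ_apply_apply] at hx hy
        simp only [LinearMap.comp_apply, LinearMap.applyₗ_apply_apply]
        rw [map_add, map_add, hx, hy, map_add, map_add]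
      | tmul x y => simp [hg, endMapHM]) h

/-- The functor `M ↦ M̂`, `g ↦ (φ ↦ g ∘ φ)`, once every `M̂` has been given a `YD_{i+1}`-contramodule
structure with action `h · f = h² f(S(h³) - S^{-2i}(h¹))` and contraaction
`αθ(h) = θ_{h¹}(h²)`. -/
noncomputable def hatFunctor {i : ℤ}
    (s : ∀ M : YDModCat.{u, v, max v w} k H (i - 1),
      YDContramodule k H (i + 1) (hat M.str.toRightComodule))
    (hact : ∀ M h f, (((s M).act h f : hat M.str.toRightComodule) : H →ₗ[k] M.carrier) =
      twistHom M.str.act (-2 * i) h f)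
    (hcontra : ∀ M θ, (((s M).contra θ : hat M.str.toRightComodule) : H →ₗ[k] M.carrier) =
      hatContra M.str.toRightComodule θ) :
    YDModCat.{u, v, max v w} k H (i - 1) ⥤ YDContraCat.{u, v, max v w} k H (i + 1) where
  obj M := ⟨hat M.str.toRightComodule, s M⟩
  map {M M'} g :=
    { hom := hatMap g.hom g.map_coact
      map_act := by
        intro h f
        apply Subtype.ext
        rw [coe_hatMap, hact, hact, coe_hatMap]
        exact twistHom_comp _ _ _ _ g.map_act _ _
      map_contra := by
        intro θ
        apply Subtype.ext
        rw [coe_hatMap, hcontra, hcontra]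
        ext h
        simp only [hatContra, LinearMap.comp_apply]
        generalize Coalgebra.comul (R := k) h = t
        induction t with
        | zero => simp
        | add x y hx hy => simp only [map_add, hx, hy]
        | tmul x y => simp [coe_hatMap] }
  map_id M := rfl
  map_comp f g := rfl

/-- The functor `N ↦ N'`, `g ↦ (h ⊗ n ↦ h ⊗ g(n))`, once every `N'` has been given a
`YD_{i-1}`-module structure with action `h · (x ⊗ n) = h³ x S^{1-2i}(h¹) ⊗ h² n` and coaction
`h ⊗ n ↦ (h¹ ⊗ n) ⊗ h²`. -/
noncomputable def primeFunctor {i : ℤ}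
    (t : ∀ N : YDContraCat.{u, v, max v w} k H (i + 1),
      YDModule k H (i - 1) (Prime N.str.toRightContramodule))
    (hact : ∀ N h x, (t N).act h (primeMk N.str.toRightContramodule x) =
      primeMk N.str.toRightContramodule (twistHM N.str.act (1 - 2 * i) h x))
    (hcoact : ∀ N x, (t N).coact (primeMk N.str.toRightContramodule x) =
      (primeMk N.str.toRightContramodule).rTensor H (primeCoact k H N.carrier x)) :
    YDContraCat.{u, v, max v w} k H (i + 1) ⥤ YDModCat.{u, v, max v w} k H (i - 1) where
  obj N := ⟨Prime N.str.toRightContramodule, t N⟩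
  map {N N₁} g :=
    { hom := primeMap g.hom g.map_contra
      map_act := by
        intro h x
        obtain ⟨x, rfl⟩ := primeMk_surjective _ x
        exact (congrArg _ (hact N h x)).trans ((congrArg (primeMk _)
          (twistHM_lTensor _ _ _ _ g.map_act h x)).trans (hact N₁ h _).symm)
      map_coact := by
        intro x
        obtain ⟨x, rfl⟩ := primeMk_surjective _ x
        exact (hcoact N₁ _).trans ((primeMap_coact g.hom g.map_contra x).symm.trans
          (congrArg _ (hcoact N x).symm)) }
  map_id N := YDModCat.Hom.ext (primeMap_id N.str.toRightContramodule)
  map_comp f g := YDModCat.Hom.ext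
    (primeMap_comp f.hom f.map_contra g.hom g.map_contra (f ≫ g).map_contra)

end Functors

end HopfYD

/-! Put n = -2i, an even integer. A `YD_{i-1}`-module has exponent -1-2(i-1) = n+1 in its coaction
law, and a `YD_{i+1}`-contramodule has exponent 2-2(i+1) = n in its contraaction law. The whole
theorem can therefore be proved for one even n. Then S^n is a bialgebra automorphism, S^{n+1}
reverses both product and coproduct, and the two are convolution inverse to each other.

The adjunction is the tensor-hom adjunction: F : H ⊗ N → M corresponds to G : N → Hom(H, M), G(y)(x)
= F(x ⊗ y). Under it, F is colinear iff G takes values in M̂. F kills the relations of N' iff G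
respects contraactions, because F(h² ⊗ f(h¹)) = G(f(h¹))(h²). F is H-linear iff G is, since the
operators x ↦ h³ x S^{n+1}(h¹) and x ↦ S(h³) x S^n(h¹) undo each other under convolution
(`lift_twistHM_iff`).

It remains to check that the structures on M̂ and N' are well defined and compatible
(`twistHom_mem_hat`, `diagonal_twistHom`, `evalMap_twistHM`, `primeCoact_twistHM`). Every twisted
action has the form h ↦ u(h¹) v(h³) m(h²), called `twoSided`, with u a right and v a left
multiplication operator. A twisted action inside another merges into a single one
(`twoSided_twoSided`), and a linear map commutes with such an expression as soon as it does so
separately at the outer ends u and v (`map_twoSided`). Each compatibility thus splits into two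
identities in H ⊗ H, such as Δ(S^n(h¹))(1 ⊗ S^{n+1}(h²)) = S^n(h) ⊗ 1, which follow from the
antipode axioms. This avoids computing with five Sweedler legs at once. -/

namespace HopfYD

/-! ### Convolution, and the antipode as an anti-coalgebra map. -/

section Convolution

variable {k H : Type*} [Field k] [Ring H] [HopfAlgebra k H]
  {P Q R P' Q' R' W : Type*} [AddCommGroup P] [Module k P] [AddCommGroup Q] [Module k Q]
  [AddCommGroup R] [Module k R] [AddCommGroup P'] [Module k P'] [AddCommGroup Q'] [Module k Q']
  [AddCommGroup R'] [Module k R'] [AddCommGroup W] [Module k W]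

/-- The convolution `h ↦ ∑ c (f h¹) (g h²)` of `f` and `g` along a bilinear map `c`. -/
noncomputable def conv (c : P →ₗ[k] Q →ₗ[k] R) (f : H →ₗ[k] P) (g : H →ₗ[k] Q) : H →ₗ[k] R :=
  TensorProduct.lift (c.compl₁₂ f g) ∘ₗ Coalgebra.comul

/-- Both sides are linear in Δ(h), so they need only be compared on simple tensors. This is how a
pointwise identity is passed under a Sweedler sum throughout. -/
theorem conv_congr {c : P →ₗ[k] Q →ₗ[k] R} {f : H →ₗ[k] P} {g : H →ₗ[k] Q}
    {c' : P' →ₗ[k] Q' →ₗ[k] R'} {f' : H →ₗ[k] P'} {g' : H →ₗ[k] Q'}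
    (L : R →ₗ[k] W) (L' : R' →ₗ[k] W)
    (hL : ∀ a b, L (c (f a) (g b)) = L' (c' (f' a) (g' b))) (h : H) :
    L (conv c f g h) = L' (conv c' f' g' h) := by
  simp only [conv, LinearMap.comp_apply]
  generalize Coalgebra.comul (R := k) h = t
  induction t with
  | zero => simp
  | add x y hx hy => simp only [map_add, hx, hy]
  | tmul x y => simp [hL]

theorem conv_assoc {P₁ P₂ P₃ P₁₂ P₂₃ : Type*}
    [AddCommGroup P₁] [Module k P₁] [AddCommGroup P₂] [Module k P₂] [AddCommGroup P₃] [Module k P₃]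
    [AddCommGroup P₁₂] [Module k P₁₂] [AddCommGroup P₂₃] [Module k P₂₃]
    {c : P₁₂ →ₗ[k] P₃ →ₗ[k] R} {d : P₁ →ₗ[k] P₂ →ₗ[k] P₁₂} {c' : P₁ →ₗ[k] P₂₃ →ₗ[k] R}
    {d' : P₂ →ₗ[k] P₃ →ₗ[k] P₂₃} {f₁ : H →ₗ[k] P₁} {f₂ : H →ₗ[k] P₂} {f₃ : H →ₗ[k] P₃}
    (hc : ∀ x y z, c (d (f₁ x) (f₂ y)) (f₃ z) = c' (f₁ x) (d' (f₂ y) (f₃ z))) :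
    conv c (conv d f₁ f₂) f₃ = conv c' f₁ (conv d' f₂ f₃) := by
  ext h
  have h₁ : conv c (conv d f₁ f₂) f₃ h =
      TensorProduct.lift (c.compl₁₂ (TensorProduct.lift (d.compl₁₂ f₁ f₂)) f₃)
        ((Coalgebra.comul (R := k)).rTensor H (Coalgebra.comul h)) := by
    simp only [conv, LinearMap.comp_apply]
    generalize Coalgebra.comul (R := k) h = t
    induction t with
    | zero => simp
    | add x y hx hy => simp only [map_add, hx, hy]
    | tmul x y => simp
  have h₂ : conv c' f₁ (conv d' f₂ f₃) h =
      TensorProduct.lift (c'.compl₁₂ f₁ (TensorProduct.lift (d'.compl₁₂ f₂ f₃)))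
        ((Coalgebra.comul (R := k)).lTensor H (Coalgebra.comul h)) := by
    simp only [conv, LinearMap.comp_apply]
    generalize Coalgebra.comul (R := k) h = t
    induction t with
    | zero => simp
    | add x y hx hy => simp only [map_add, hx, hy]
    | tmul x y => simp
  rw [h₁, h₂, ← Coalgebra.coassoc_apply]
  generalize (Coalgebra.comul (R := k)).rTensor H (Coalgebra.comul h) = t
  induction t with
  | zero => simp
  | add x y hx hy => simp only [map_add, hx, hy]
  | tmul x z =>
    induction x with
    | zero => simp
    | add x y hx hy => simp only [map_add, TensorProduct.add_tmul, hx, hy]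
    | tmul x y => simp [hc]

theorem conv_counit_right {c : P →ₗ[k] Q →ₗ[k] R} {f : H →ₗ[k] P} {g : H →ₗ[k] Q} {m : H →ₗ[k] R}
    (hc : ∀ a b, c (f a) (g b) = Coalgebra.counit (R := k) b • m a) : conv c f g = m := by
  ext h
  have h₁ : conv c f g h =
      (m ∘ₗ (TensorProduct.rid k H).toLinearMap)
        ((Coalgebra.counit (R := k)).lTensor H (Coalgebra.comul h)) := by
    simp only [conv, LinearMap.comp_apply]
    generalize Coalgebra.comul (R := k) h = t
    induction t with
    | zero => simp
    | add x y hx hy => simp only [map_add, hx, hy]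
    | tmul x y => simp [hc]
  simp [h₁]

theorem conv_counit_left {c : P →ₗ[k] Q →ₗ[k] R} {f : H →ₗ[k] P} {g : H →ₗ[k] Q} {m : H →ₗ[k] R}
    (hc : ∀ a b, c (f a) (g b) = Coalgebra.counit (R := k) a • m b) : conv c f g = m := by
  ext h
  have h₁ : conv c f g h =
      (m ∘ₗ (TensorProduct.lid k H).toLinearMap)
        ((Coalgebra.counit (R := k)).rTensor H (Coalgebra.comul h)) := by
    simp only [conv, LinearMap.comp_apply]
    generalize Coalgebra.comul (R := k) h = t
    induction t with
    | zero => simp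
    | add x y hx hy => simp only [map_add, hx, hy]
    | tmul x y => simp [hc]
  simp [h₁]

theorem conv_map (f : H →ₗ[k] P) (g : H →ₗ[k] Q) (h : H) :
    conv (TensorProduct.mk k P Q) f g h = TensorProduct.map f g (Coalgebra.comul h) := by
  simp only [conv, LinearMap.comp_apply]
  congr 1

theorem conv_mul_antipode (h : H) :
    conv (LinearMap.mul k H) LinearMap.id (HopfAlgebra.antipode k) h =
      algebraMap k H (Coalgebra.counit h) := by
  rw [← HopfAlgebra.mul_antipode_lTensor_comul_apply]
  simp only [conv, LinearMap.comp_apply]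
  generalize Coalgebra.comul (R := k) h = t
  induction t with
  | zero => simp
  | add x y hx hy => simp only [map_add, hx, hy]
  | tmul x y => simp

theorem conv_antipode_mul (h : H) :
    conv (LinearMap.mul k H) (HopfAlgebra.antipode k) LinearMap.id h =
      algebraMap k H (Coalgebra.counit h) := by
  rw [← HopfAlgebra.mul_antipode_rTensor_comul_apply]
  simp only [conv, LinearMap.comp_apply]
  generalize Coalgebra.comul (R := k) h = t
  induction t with
  | zero => simp
  | add x y hx hy => simp only [map_add, hx, hy]
  | tmul x y => simp

variable (k H) in
/-- `x ↦ x ⊗ 1`. -/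
noncomputable def inl : H →ₗ[k] H ⊗[k] H := (TensorProduct.mk k H H).flip 1

variable (k H) in
/-- `x ↦ 1 ⊗ x`. -/
noncomputable def inr : H →ₗ[k] H ⊗[k] H := TensorProduct.mk k H H 1

@[simp] theorem inl_apply (x : H) : inl k H x = x ⊗ₜ 1 := rfl
@[simp] theorem inr_apply (x : H) : inr k H x = 1 ⊗ₜ x := rfl

/-- The convolution product of maps into `H ⊗ H`. -/
noncomputable abbrev convT (f g : H →ₗ[k] H ⊗[k] H) : H →ₗ[k] H ⊗[k] H :=
  conv (LinearMap.mul k (H ⊗[k] H)) f g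

theorem convT_assoc (f g e : H →ₗ[k] H ⊗[k] H) : convT (convT f g) e = convT f (convT g e) :=
  conv_assoc fun _ _ _ => by simp [mul_assoc]

/-- The unit of the convolution product of maps into `H ⊗ H`. -/
noncomputable def unitT : H →ₗ[k] H ⊗[k] H :=
  Algebra.linearMap k (H ⊗[k] H) ∘ₗ Coalgebra.counit

theorem convT_unit (f : H →ₗ[k] H ⊗[k] H) : convT f unitT = f :=
  conv_counit_right fun a b => by simp [unitT, Algebra.algebraMap_eq_smul_one]

theorem unit_convT (f : H →ₗ[k] H ⊗[k] H) : convT unitT f = f :=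
  conv_counit_left fun a b => by simp [unitT, Algebra.algebraMap_eq_smul_one]

theorem convT_inl {f g : H →ₗ[k] H}
    (hfg : ∀ h, conv (LinearMap.mul k H) f g h = algebraMap k H (Coalgebra.counit h)) :
    convT (inl k H ∘ₗ f) (inl k H ∘ₗ g) = unitT := by
  ext h
  refine (conv_congr LinearMap.id (inl k H) (c' := LinearMap.mul k H) (f' := f) (g' := g)
    (fun a b => by simp) h).trans ?_
  rw [hfg]
  simp [unitT, Algebra.algebraMap_eq_smul_one, TensorProduct.smul_tmul',
    Algebra.TensorProduct.one_def]

theorem convT_inr {f g : H →ₗ[k] H}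
    (hfg : ∀ h, conv (LinearMap.mul k H) f g h = algebraMap k H (Coalgebra.counit h)) :
    convT (inr k H ∘ₗ f) (inr k H ∘ₗ g) = unitT := by
  ext h
  refine (conv_congr LinearMap.id (inr k H) (c' := LinearMap.mul k H) (f' := f) (g' := g)
    (fun a b => by simp) h).trans ?_
  rw [hfg]
  simp [unitT, Algebra.algebraMap_eq_smul_one,
    Algebra.TensorProduct.one_def]

theorem convT_inl_inr (f g : H →ₗ[k] H) (h : H) :
    convT (inl k H ∘ₗ f) (inr k H ∘ₗ g) h = TensorProduct.map f g (Coalgebra.comul h) := by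
  rw [← conv_map]
  exact conv_congr LinearMap.id LinearMap.id (fun a b => by simp) h

theorem comul_eq_convT : (Coalgebra.comul : H →ₗ[k] H ⊗[k] H) =
    convT (inl k H ∘ₗ LinearMap.id) (inr k H ∘ₗ LinearMap.id) := by
  ext h
  rw [convT_inl_inr, TensorProduct.map_id]
  rfl

/-- The antipode reverses the comultiplication. -/
theorem comul_comp_antipode :
    Coalgebra.comul ∘ₗ HopfAlgebra.antipode k =
      convT (inr k H ∘ₗ HopfAlgebra.antipode k) (inl k H ∘ₗ HopfAlgebra.antipode k) := by
  -- Δ∘S is a left convolution inverse of Δ and the flipped product is a right one; by associativity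
  -- they coincide.
  have hl : convT (Coalgebra.comul ∘ₗ HopfAlgebra.antipode k)
      (Coalgebra.comul : H →ₗ[k] H ⊗[k] H) = unitT := by
    ext h
    refine (conv_congr LinearMap.id (Coalgebra.comul (R := k)) (c' := LinearMap.mul k H)
      (f' := HopfAlgebra.antipode k) (g' := LinearMap.id) (fun a b => by simp) h).trans ?_
    rw [conv_antipode_mul]
    simp [unitT]
  have hr : convT (Coalgebra.comul : H →ₗ[k] H ⊗[k] H)
      (convT (inr k H ∘ₗ HopfAlgebra.antipode k) (inl k H ∘ₗ HopfAlgebra.antipode k)) = unitT := by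
    rw [comul_eq_convT, convT_assoc, ← convT_assoc (inr k H ∘ₗ LinearMap.id),
      convT_inr conv_mul_antipode, unit_convT, convT_inl conv_mul_antipode]
  rw [← convT_unit (Coalgebra.comul ∘ₗ HopfAlgebra.antipode k), ← hr, ← convT_assoc, hl, unit_convT]

theorem convT_inr_inl_comm (f g : H →ₗ[k] H) (h : H) :
    convT (inr k H ∘ₗ f) (inl k H ∘ₗ g) h =
      TensorProduct.map g f (TensorProduct.comm k H H (Coalgebra.comul h)) := by
  simp only [conv, LinearMap.comp_apply]
  generalize Coalgebra.comul (R := k) h = t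
  induction t with
  | zero => simp
  | add x y hx hy => simp only [map_add, hx, hy]
  | tmul x y => simp

theorem comul_antipode (h : H) : Coalgebra.comul (HopfAlgebra.antipode k h) =
    TensorProduct.map (HopfAlgebra.antipode k) (HopfAlgebra.antipode k)
      (TensorProduct.comm k H H (Coalgebra.comul h)) := by
  rw [← convT_inr_inl_comm, ← comul_comp_antipode]
  rfl

/-- In (1 ⊗ h¹)Δ(S(h²)) the factor h¹S(h²) in the second leg collapses to a counit. -/
theorem inr_convT_comul_antipode :
    convT (inr k H ∘ₗ LinearMap.id) (Coalgebra.comul ∘ₗ HopfAlgebra.antipode k) =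
      inl k H ∘ₗ HopfAlgebra.antipode k := by
  rw [comul_comp_antipode, ← convT_assoc, convT_inr conv_mul_antipode, unit_convT]

theorem inl_antipode_convT_comul :
    convT (inl k H ∘ₗ HopfAlgebra.antipode k) Coalgebra.comul = inr k H ∘ₗ LinearMap.id := by
  rw [comul_eq_convT, ← convT_assoc, convT_inl conv_antipode_mul, unit_convT]

end Convolution

/-! ### Integer powers of the antipode, by parity. -/

section Antipode

variable (k H : Type*) [Field k] [Ring H] [HopfAlgebra k H]

/-- The linear automorphisms of `H` respecting its multiplication, unit and comultiplication. -/
def bialgebraAut : Subgroup (H ≃ₗ[k] H) where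
  carrier := {f | (∀ a b, f (a * b) = f a * f b) ∧ f 1 = 1 ∧
    ∀ h, Coalgebra.comul (f h) = TensorProduct.map f.toLinearMap f.toLinearMap (Coalgebra.comul h)}
  one_mem' := ⟨fun _ _ => rfl, rfl, fun h =>
    (congrArg (fun e : H ⊗[k] H →ₗ[k] H ⊗[k] H => e (Coalgebra.comul h)) TensorProduct.map_id).symm⟩
  mul_mem' := by
    rintro f g ⟨hf₁, hf₂, hf₃⟩ ⟨hg₁, hg₂, hg₃⟩
    refine ⟨fun a b => ?_, ?_, fun h => ?_⟩
    · simp [hf₁, hg₁]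
    · simp [hf₂, hg₂]
    · rw [LinearEquiv.mul_apply, hf₃, hg₃, ← LinearMap.comp_apply, ← TensorProduct.map_comp]
      rfl
  inv_mem' := by
    rintro f ⟨hf₁, hf₂, hf₃⟩
    have hi : ∀ a, f (f⁻¹ a) = a := f.apply_symm_apply
    have hi' : f.toLinearMap ∘ₗ (f⁻¹ : H ≃ₗ[k] H).toLinearMap = LinearMap.id :=
      LinearMap.ext hi
    refine ⟨fun a b => ?_, ?_, fun h => ?_⟩
    · apply f.injective
      rw [hf₁, hi, hi, hi]
    · apply f.injective
      rw [hf₂, hi]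
    · apply (TensorProduct.congr f f).injective
      change TensorProduct.map f.toLinearMap f.toLinearMap _ =
        TensorProduct.map f.toLinearMap f.toLinearMap _
      rw [← hf₃, hi, ← LinearMap.comp_apply, ← TensorProduct.map_comp, hi', TensorProduct.map_id]
      rfl

variable {k H} [BijectiveAntipode k H]

/-- Two order reversals cancel. Since `bialgebraAut` is a subgroup, this one case yields every even
power, negative ones included. -/
theorem antipodeEquiv_sq_mem : antipodeEquiv k H ^ (2 : ℤ) ∈ bialgebraAut k H := by
  have h₂ : ∀ h, (antipodeEquiv k H ^ (2 : ℤ)) h =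
      HopfAlgebra.antipode k (HopfAlgebra.antipode k h) := fun _ => rfl
  refine ⟨fun a b => ?_, ?_, fun h => ?_⟩
  · rw [h₂, h₂, h₂, HopfAlgebra.antipode_mul_antidistrib, HopfAlgebra.antipode_mul_antidistrib]
  · rw [h₂, HopfAlgebra.antipode_one, HopfAlgebra.antipode_one]
  · rw [h₂, comul_antipode, comul_antipode]
    generalize Coalgebra.comul (R := k) h = t
    induction t with
    | zero => simp
    | add x y hx hy => simp only [map_add, hx, hy]
    | tmul x y => rfl

theorem antipodePow_mem {n : ℤ} (hn : Even n) : antipodeEquiv k H ^ n ∈ bialgebraAut k H := by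
  obtain ⟨m, rfl⟩ := hn
  rw [← two_mul, zpow_mul]
  exact Subgroup.zpow_mem _ antipodeEquiv_sq_mem m

theorem antipodePow_mul {n : ℤ} (hn : Even n) (a b : H) :
    antipodePow k H n (a * b) = antipodePow k H n a * antipodePow k H n b :=
  (antipodePow_mem hn).1 a b

theorem antipodePow_one {n : ℤ} (hn : Even n) : antipodePow k H n 1 = 1 :=
  (antipodePow_mem hn).2.1

theorem comul_antipodePow {n : ℤ} (hn : Even n) (h : H) :
    Coalgebra.comul (antipodePow k H n h) =
      TensorProduct.map (antipodePow k H n) (antipodePow k H n) (Coalgebra.comul h) :=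
  (antipodePow_mem hn).2.2 h

theorem antipodePow_add_one (n : ℤ) (h : H) :
    antipodePow k H (n + 1) h = antipodePow k H n (HopfAlgebra.antipode k h) := by
  simp only [antipodePow, zpow_add_one]
  rfl

theorem antipodePow_add_one_mul {n : ℤ} (hn : Even n) (a b : H) :
    antipodePow k H (n + 1) (a * b) = antipodePow k H (n + 1) b * antipodePow k H (n + 1) a := by
  simp [antipodePow_add_one, HopfAlgebra.antipode_mul_antidistrib, antipodePow_mul hn]

theorem antipodePow_add_one_one {n : ℤ} (hn : Even n) : antipodePow k H (n + 1) 1 = 1 := by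
  simp [antipodePow_add_one, antipodePow_one hn]

theorem comul_comp_antipodePow {n : ℤ} (hn : Even n) :
    Coalgebra.comul ∘ₗ antipodePow k H n =
      convT (inl k H ∘ₗ antipodePow k H n) (inr k H ∘ₗ antipodePow k H n) := by
  ext h
  rw [convT_inl_inr, ← comul_antipodePow hn]
  rfl

theorem comul_comp_antipodePow_add_one {n : ℤ} (hn : Even n) :
    Coalgebra.comul ∘ₗ antipodePow k H (n + 1) =
      convT (inr k H ∘ₗ antipodePow k H (n + 1)) (inl k H ∘ₗ antipodePow k H (n + 1)) := by
  ext h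
  rw [convT_inr_inl_comm, LinearMap.comp_apply, antipodePow_add_one, comul_antipodePow hn,
    comul_antipode]
  generalize Coalgebra.comul (R := k) h = t
  induction t with
  | zero => simp
  | add x y hx hy => simp only [map_add, hx, hy]
  | tmul x y => simp [antipodePow_add_one]

/-- Apply the unital algebra map S^n to h¹S(h²) = ε(h). -/
theorem conv_antipodePow_mul {n : ℤ} (hn : Even n) (h : H) :
    conv (LinearMap.mul k H) (antipodePow k H n) (antipodePow k H (n + 1)) h =
      algebraMap k H (Coalgebra.counit h) := by
  refine (conv_congr LinearMap.id (antipodePow k H n) (c' := LinearMap.mul k H)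
    (f' := LinearMap.id) (g' := HopfAlgebra.antipode k)
    (fun a b => by simp [antipodePow_add_one, antipodePow_mul hn]) h).trans ?_
  rw [conv_mul_antipode]
  simp [Algebra.algebraMap_eq_smul_one, antipodePow_one hn]

theorem conv_antipodePow_add_one_mul {n : ℤ} (hn : Even n) (h : H) :
    conv (LinearMap.mul k H) (antipodePow k H (n + 1)) (antipodePow k H n) h =
      algebraMap k H (Coalgebra.counit h) := by
  refine (conv_congr LinearMap.id (antipodePow k H n) (c' := LinearMap.mul k H)
    (f' := HopfAlgebra.antipode k) (g' := LinearMap.id)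
    (fun a b => by simp [antipodePow_add_one, antipodePow_mul hn]) h).trans ?_
  rw [conv_antipode_mul]
  simp [Algebra.algebraMap_eq_smul_one, antipodePow_one hn]

theorem comul_antipodePow_convT_inr {n : ℤ} (hn : Even n) :
    convT (Coalgebra.comul ∘ₗ antipodePow k H n) (inr k H ∘ₗ antipodePow k H (n + 1)) =
      inl k H ∘ₗ antipodePow k H n := by
  rw [comul_comp_antipodePow hn, convT_assoc, convT_inr (conv_antipodePow_mul hn), convT_unit]

theorem comul_antipodePow_add_one_convT_inl {n : ℤ} (hn : Even n) :
    convT (Coalgebra.comul ∘ₗ antipodePow k H (n + 1)) (inl k H ∘ₗ antipodePow k H n) =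
      inr k H ∘ₗ antipodePow k H (n + 1) := by
  rw [comul_comp_antipodePow_add_one hn, convT_assoc, convT_inl (conv_antipodePow_add_one_mul hn),
    convT_unit]

end Antipode

/-! ### Calculus of expressions u(h¹) v(h³) m(h²). -/

section TwoSided

variable {k H : Type*} [Field k] [Ring H] [HopfAlgebra k H]
  {E E' : Type*} [AddCommGroup E] [Module k E] [AddCommGroup E'] [Module k E']

/-- `h ↦ ∑ u(h¹) (v(h³) (m h²))`. -/
noncomputable def twoSided (u v : H →ₗ[k] Module.End k E) (m : H →ₗ[k] E) : H →ₗ[k] E :=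
  conv LinearMap.id u (conv LinearMap.id.flip m v)

/-- `h ↦ ∑ u(h¹) ∘ u'(h²)`. -/
noncomputable abbrev convEnd (u u' : H →ₗ[k] Module.End k E) : H →ₗ[k] Module.End k E :=
  conv (LinearMap.mul k (Module.End k E)) u u'

/-- `h ↦ ∑ v(h²) ∘ v'(h¹)`. -/
noncomputable abbrev convEndOp (v' v : H →ₗ[k] Module.End k E) : H →ₗ[k] Module.End k E :=
  conv (LinearMap.mul k (Module.End k E)).flip v' v

/-- By coassociativity the left side is u(h¹) v(h⁵) u'(h²) v'(h⁴) m(h³). Commuting v past u' gathers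
the two outer legs on each side, which is why v and v' compose in the opposite order. -/
theorem twoSided_twoSided {u v u' v' : H →ₗ[k] Module.End k E} (m : H →ₗ[k] E)
    (hc : ∀ a c x, u' a (v c x) = v c (u' a x)) :
    twoSided u v (twoSided u' v' m) = twoSided (convEnd u u') (convEndOp v' v) m := by
  have h₁ : conv LinearMap.id.flip (conv LinearMap.id u' (conv LinearMap.id.flip m v')) v =
      conv LinearMap.id u' (conv LinearMap.id.flip (conv LinearMap.id.flip m v') v) :=
    conv_assoc fun x y z => by simp [hc]
  have h₂ : conv LinearMap.id.flip (conv LinearMap.id.flip m v') v =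
      conv LinearMap.id.flip m (convEndOp v' v) :=
    conv_assoc fun x y z => by simp
  have h₃ : ∀ n : H →ₗ[k] E,
      conv LinearMap.id u (conv LinearMap.id u' n) = conv LinearMap.id (convEnd u u') n :=
    fun n => (conv_assoc fun x y z => by simp).symm
  rw [twoSided, twoSided, h₁, h₂, h₃, twoSided]

theorem map_twoSided {u v : H →ₗ[k] Module.End k E} {u' v' : H →ₗ[k] Module.End k E'}
    (C : E →ₗ[k] E') (m : H →ₗ[k] E) (hu : ∀ h x, C (u h x) = u' h (C x))
    (hv : ∀ h x, C (v h x) = v' h (C x)) :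
    C ∘ₗ twoSided u v m = twoSided u' v' (C ∘ₗ m) := by
  have h₁ : C ∘ₗ conv LinearMap.id.flip m v = conv LinearMap.id.flip (C ∘ₗ m) v' :=
    LinearMap.ext fun h => conv_congr C LinearMap.id (fun a b => by simp [hv]) h
  rw [twoSided, twoSided, ← h₁]
  exact LinearMap.ext fun h => conv_congr C LinearMap.id (fun a b => by simp [hu]) h

theorem twoSided_counit {u v : H →ₗ[k] Module.End k E} (m : H →ₗ[k] E)
    (hu : ∀ h x, u h x = Coalgebra.counit (R := k) h • x)
    (hv : ∀ h x, v h x = Coalgebra.counit (R := k) h • x) : twoSided u v m = m := by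
  have h₁ : conv LinearMap.id.flip m v = m := conv_counit_right fun a b => by simp [hv]
  rw [twoSided, h₁]
  exact conv_counit_left fun a b => by simp [hu]

/-- `sweedler₃` and `twoSided` are both bracketed to the right, as (Id ⊗ Δ)Δ, so no coassociativity
is needed. This is the passage from the twisted actions of the statement to the calculus above. -/
theorem map_twist {M P : Type*} [AddCommGroup M] [Module k M] [AddCommMonoid P] [Module k P]
    {Φ : Module.End k M →ₗ[k] Module.End k H →ₗ[k] P} {act : H →ₐ[k] Module.End k M}
    {σ τ : H →ₗ[k] H} (L : P →ₗ[k] E) (u v : H →ₗ[k] Module.End k E) (m : H →ₗ[k] E)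
    (hL : ∀ a b c, L (Φ (act b) (sandwich k H (τ a) (σ c))) = u a (v c (m b))) :
    L ∘ₗ twist k H Φ act σ τ = twoSided u v m := by
  ext h
  have h₁ : ∀ t : H ⊗[k] H, TensorProduct.lift ((LinearMap.id : Module.End k E →ₗ[k] _).compl₁₂ u
        (conv LinearMap.id.flip m v)) t =
      TensorProduct.lift ((LinearMap.id : Module.End k E →ₗ[k] _).compl₁₂ u
        (TensorProduct.lift (LinearMap.id.flip.compl₁₂ m v)))
        ((Coalgebra.comul (R := k)).lTensor H t) := by
    intro t
    induction t with
    | zero => simp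
    | add x y hx hy => simp only [map_add, hx, hy]
    | tmul x y => simp [conv]
  rw [twoSided, conv, LinearMap.comp_apply _ Coalgebra.comul, h₁]
  simp only [twist, sweedler₃, LinearMap.comp_apply]
  generalize (LinearMap.lTensor H (Coalgebra.comul (R := k) (A := H))) (Coalgebra.comul h) = t
  induction t with
  | zero => simp
  | add x y hx hy => simp only [map_add, hx, hy]
  | tmul x y =>
    induction y with
    | zero => simp
    | add y z hy hz => simp only [TensorProduct.tmul_add, map_add, hy, hz]
    | tmul y z => simp [hL]

end TwoSided

/-! ### The twisted operators are actions of the algebra H. -/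

section TwistMul

variable {k H : Type*} [Field k] [Ring H] [HopfAlgebra k H]

theorem sweedler₃_mul {A : Type*} [Ring A] [Algebra k A] (T : H →ₗ[k] H →ₗ[k] H →ₗ[k] A)
    (hT : ∀ a a' b b' c c', T (a * a') (b * b') (c * c') = T a b c * T a' b' c') (g h : H) :
    sweedler₃ k H T (g * h) = sweedler₃ k H T g * sweedler₃ k H T h := by
  have h₁ : ∀ x y : H ⊗[k] H, (Coalgebra.comul (R := k) (A := H)).lTensor H (x * y) =
      (Coalgebra.comul (R := k)).lTensor H x * (Coalgebra.comul (R := k)).lTensor H y :=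
    map_mul (Algebra.TensorProduct.map (AlgHom.id k H) (Bialgebra.comulAlgHom k H))
  simp only [sweedler₃, LinearMap.comp_apply, Bialgebra.comul_mul, h₁]
  generalize (LinearMap.lTensor H (Coalgebra.comul (R := k) (A := H))) (Coalgebra.comul h) = t
  generalize (LinearMap.lTensor H (Coalgebra.comul (R := k) (A := H))) (Coalgebra.comul g) = s
  induction t with
  | zero => simp
  | add x y hx hy => simp only [map_add, mul_add, hx, hy]
  | tmul a' y =>
    induction y with
    | zero => simp
    | add y z hy hz => simp only [TensorProduct.tmul_add, map_add, mul_add, hy, hz]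
    | tmul b' c' =>
      induction s with
      | zero => simp
      | add x y hx hy => simp only [map_add, add_mul, hx, hy]
      | tmul a y =>
        induction y with
        | zero => simp
        | add y z hy hz => simp only [TensorProduct.tmul_add, map_add, add_mul, hy, hz]
        | tmul b c => simp [hT]

/-- Since Δ is multiplicative, only the factorwise law `hΦ` matters. On Hom(H, M), precomposition
reverses the order, so σ = S must reverse products and τ = S^n must preserve them; on H ⊗ M, σ is
the identity and τ = S^{n+1} must reverse them. This is where the parity of n enters. -/
theorem twist_mul {M E : Type*} [AddCommGroup M] [Module k M] [AddCommGroup E] [Module k E]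
    (Φ : Module.End k M →ₗ[k] Module.End k H →ₗ[k] Module.End k E)
    (act : H →ₐ[k] Module.End k M) (σ τ : H →ₗ[k] H)
    (hΦ : ∀ a a' b b' c c',
      Φ (act b * act b') (sandwich k H (τ (a * a')) (σ (c * c'))) =
        Φ (act b) (sandwich k H (τ a) (σ c)) * Φ (act b') (sandwich k H (τ a') (σ c')))
    (g h : H) :
    twist k H Φ act σ τ (g * h) = twist k H Φ act σ τ g * twist k H Φ act σ τ h :=
  sweedler₃_mul _ (fun a a' b b' c c' => by simpa using hΦ a a' b b' c c') g h

theorem twist_one {M P : Type*} [AddCommGroup M] [Module k M] [AddCommMonoid P] [Module k P]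
    (Φ : Module.End k M →ₗ[k] Module.End k H →ₗ[k] P)
    (act : H →ₐ[k] Module.End k M) (σ τ : H →ₗ[k] H) (hσ : σ 1 = 1) (hτ : τ 1 = 1) :
    twist k H Φ act σ τ 1 = Φ 1 1 := by
  have : sandwich k H 1 1 = 1 := by ext; simp [sandwich]
  simp [twist, sweedler₃, Algebra.TensorProduct.one_def, hσ, hτ, this]

variable [BijectiveAntipode k H]

/-- The action `h · f = ∑ h² f(S(h³) - S^n(h¹))` on `Hom(H, M)`, for even `n`. -/
noncomputable def homAct {M : Type w} [AddCommGroup M] [Module k M] (act : H →ₐ[k] Module.End k M)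
    {n : ℤ} (hn : Even n) : H →ₐ[k] Module.End k (H →ₗ[k] M) :=
  AlgHom.ofLinearMap (twistHom act n)
    ((twist_one (conjHom k H M) act _ _ HopfAlgebra.antipode_one (antipodePow_one hn)).trans
      (by ext; simp [conjHom]))
    (twist_mul (conjHom k H M) act _ _ fun a a' b b' c c' => by
      ext
      simp [conjHom, sandwich, HopfAlgebra.antipode_mul_antidistrib, antipodePow_mul hn, mul_assoc])

theorem twistHM_one {M : Type w} [AddCommGroup M] [Module k M] (act : H →ₐ[k] Module.End k M)
    {n : ℤ} (hn : Even n) : twistHM act (n + 1) 1 = 1 := by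
  rw [twistHM, twist_one _ _ _ _ (LinearMap.id_apply 1) (antipodePow_add_one_one hn)]
  ext
  simp [endMapHM]

theorem twistHM_mul {M : Type w} [AddCommGroup M] [Module k M] (act : H →ₐ[k] Module.End k M)
    {n : ℤ} (hn : Even n) (g h : H) :
    twistHM act (n + 1) (g * h) = twistHM act (n + 1) g * twistHM act (n + 1) h :=
  twist_mul (endMapHM k H M) act _ _ (fun a a' b b' c c' => by
    ext
    simp [endMapHM, sandwich, antipodePow_add_one_mul hn, mul_assoc]) g h

/-- The action `h · (x ⊗ m) = ∑ h³ x S^{n+1}(h¹) ⊗ h² m` on `H ⊗ M`, for even `n`. -/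
noncomputable def tensorAct {M : Type w} [AddCommGroup M] [Module k M]
    (act : H →ₐ[k] Module.End k M) {n : ℤ} (hn : Even n) : H →ₐ[k] Module.End k (H ⊗[k] M) :=
  AlgHom.ofLinearMap (twistHM act (n + 1)) (twistHM_one act hn) (twistHM_mul act hn)

end TwistMul

/-! ### One-sided multiplication operators on Hom and tensor spaces. -/

section Operators

variable {k H : Type*} [Field k] [Ring H] [HopfAlgebra k H]
  {X Y : Type*} [AddCommGroup X] [Module k X] [AddCommGroup Y] [Module k Y]

/-- `a ↦ (x ↦ x τ(a))`. -/
noncomputable def mulR (τ : H →ₗ[k] H) : H →ₗ[k] Module.End k H := (LinearMap.mul k H).flip ∘ₗ τ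

/-- `a ↦ (x ↦ σ(a) x)`. -/
noncomputable def mulL (σ : H →ₗ[k] H) : H →ₗ[k] Module.End k H := LinearMap.mul k H ∘ₗ σ

/-- `a ↦ (f ↦ f ∘ c(a))`. -/
noncomputable def preOp (Y : Type*) [AddCommGroup Y] [Module k Y] (c : H →ₗ[k] Module.End k X) :
    H →ₗ[k] Module.End k (X →ₗ[k] Y) := (LinearMap.llcomp k X X Y).flip ∘ₗ c

/-- `a ↦ (f ↦ c(a) ∘ f)`. -/
noncomputable def postOp (X : Type*) [AddCommGroup X] [Module k X] (c : H →ₗ[k] Module.End k Y) :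
    H →ₗ[k] Module.End k (X →ₗ[k] Y) := LinearMap.llcomp k X Y Y ∘ₗ c

/-- `a ↦ c(a) ⊗ id`. -/
noncomputable def rTensorOp (Y : Type*) [AddCommGroup Y] [Module k Y]
    (c : H →ₗ[k] Module.End k X) : H →ₗ[k] Module.End k (X ⊗[k] Y) :=
  LinearMap.rTensorHom Y ∘ₗ c

/-- `a ↦ id ⊗ c(a)`. -/
noncomputable def lTensorOp (X : Type*) [AddCommGroup X] [Module k X]
    (c : H →ₗ[k] Module.End k Y) : H →ₗ[k] Module.End k (X ⊗[k] Y) :=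
  LinearMap.lTensorHom X ∘ₗ c

@[simp] theorem mulR_apply (τ : H →ₗ[k] H) (a x : H) : mulR τ a x = x * τ a := rfl
@[simp] theorem mulL_apply (σ : H →ₗ[k] H) (a x : H) : mulL σ a x = σ a * x := rfl
@[simp] theorem preOp_apply (c : H →ₗ[k] Module.End k X) (a : H) (f : X →ₗ[k] Y) :
    preOp Y c a f = f ∘ₗ c a := rfl
@[simp] theorem postOp_apply (c : H →ₗ[k] Module.End k Y) (a : H) (f : X →ₗ[k] Y) :
    postOp X c a f = c a ∘ₗ f := rfl
@[simp] theorem rTensorOp_apply (c : H →ₗ[k] Module.End k X) (a : H) :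
    rTensorOp Y c a = (c a).rTensor Y := rfl
@[simp] theorem lTensorOp_apply (c : H →ₗ[k] Module.End k Y) (a : H) :
    lTensorOp X c a = (c a).lTensor X := rfl

theorem mulR_eq (τ : H →ₗ[k] H) (a : H) : mulR τ a = LinearMap.mulRight k (τ a) := rfl
theorem mulL_eq (σ : H →ₗ[k] H) (a : H) : mulL σ a = LinearMap.mulLeft k (σ a) := rfl

/-- `a ↦ c(a) x`. -/
noncomputable def orbit (c : H →ₗ[k] Module.End k X) (x : X) : H →ₗ[k] X := LinearMap.applyₗ x ∘ₗ c

@[simp] theorem orbit_apply (c : H →ₗ[k] Module.End k X) (x : X) (a : H) : orbit c x a = c a x :=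
  rfl

variable {E W : Type*} [AddCommGroup E] [Module k E] [AddCommGroup W] [Module k W]

/-- When u(a)u'(b) acts only through the product f(a)g(b) in H ⊗ H, an identity between operators
reduces to one for `convT`. -/
theorem map_convEnd_convT {u u' : H →ₗ[k] Module.End k E} {f g : H →ₗ[k] H ⊗[k] H} {x : E}
    (L : E →ₗ[k] W) (L' : H ⊗[k] H →ₗ[k] W) (hL : ∀ a b, L (u a (u' b x)) = L' (f a * g b))
    (h : H) : L (convEnd u u' h x) = L' (convT f g h) :=
  conv_congr (L ∘ₗ LinearMap.applyₗ x) L' (fun a b => by simpa using hL a b) h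

theorem map_convEndOp_convT {u u' : H →ₗ[k] Module.End k E} {f g : H →ₗ[k] H ⊗[k] H} {x : E}
    (L : E →ₗ[k] W) (L' : H ⊗[k] H →ₗ[k] W) (hL : ∀ a b, L (u' b (u a x)) = L' (f a * g b))
    (h : H) : L (convEndOp u u' h x) = L' (convT f g h) :=
  conv_congr (L ∘ₗ LinearMap.applyₗ x) L' (fun a b => by simpa using hL a b) h

end Operators

/-! ### The twisted actions in two-sided form. -/

section TwistFormulas

variable {k : Type u} {H : Type v} [Field k] [Ring H] [HopfAlgebra k H]

theorem orbit_twist {M P E : Type*} [AddCommGroup M] [Module k M] [AddCommMonoid P] [Module k P]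
    [AddCommGroup E] [Module k E]
    {Φ : Module.End k M →ₗ[k] Module.End k H →ₗ[k] P} {act : H →ₐ[k] Module.End k M}
    {σ τ : H →ₗ[k] H} (J : P →ₗ[k] Module.End k E) (u v m : H →ₗ[k] Module.End k E)
    (hJ : ∀ a b c, J (Φ (act b) (sandwich k H (τ a) (σ c))) = u a ∘ₗ v c ∘ₗ m b) (x : E) :
    orbit (J ∘ₗ twist k H Φ act σ τ) x = twoSided u v (orbit m x) :=
  map_twist (LinearMap.applyₗ x ∘ₗ J) _ _ _ fun a b c => by
    rw [LinearMap.comp_apply, hJ]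
    rfl

theorem conjHom_sandwich {M : Type*} [AddCommGroup M] [Module k M] (f : Module.End k M) (a c : H) :
    conjHom k H M f (sandwich k H a c) =
      (LinearMap.llcomp k H H M).flip (LinearMap.mulRight k a) ∘ₗ
        (LinearMap.llcomp k H H M).flip (LinearMap.mulLeft k c) ∘ₗ LinearMap.llcomp k H M M f := by
  ext
  simp [conjHom, sandwich, mul_assoc]

theorem endMapHM_sandwich {M : Type*} [AddCommGroup M] [Module k M] (f : Module.End k M)
    (a c : H) : endMapHM k H M f (sandwich k H a c) =
      (LinearMap.mulRight k a).rTensor M ∘ₗ (LinearMap.mulLeft k c).rTensor M ∘ₗ f.lTensor H := by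
  ext
  simp [endMapHM, sandwich]

theorem mapBilinear_sandwich {M : Type*} [AddCommGroup M] [Module k M] (f : Module.End k M)
    (a c : H) : TensorProduct.mapBilinear (RingHom.id k) M H M H f (sandwich k H a c) =
      (LinearMap.mulRight k a).lTensor M ∘ₗ (LinearMap.mulLeft k c).lTensor M ∘ₗ f.rTensor H := by
  ext
  simp [sandwich]

variable [BijectiveAntipode k H]
  {M : Type w} [AddCommGroup M] [Module k M] (act : H →ₐ[k] Module.End k M) (n : ℤ)

theorem orbit_twistHom (f : H →ₗ[k] M) : orbit (twistHom act n) f =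
    twoSided (preOp M (mulR (antipodePow k H n))) (preOp M (mulL (HopfAlgebra.antipode k)))
      (orbit (postOp H act.toLinearMap) f) :=
  orbit_twist LinearMap.id _ _ _ (fun _ _ _ => conjHom_sandwich _ _ _) f

theorem orbit_twistHM (z : H ⊗[k] M) : orbit (twistHM act n) z =
    twoSided (rTensorOp M (mulR (antipodePow k H n))) (rTensorOp M (mulL LinearMap.id))
      (orbit (lTensorOp H act.toLinearMap) z) :=
  orbit_twist LinearMap.id _ _ _ (fun _ _ _ => endMapHM_sandwich _ _ _) z

theorem orbit_twistMH (z : M ⊗[k] H) : orbit (twistMH act n) z =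
    twoSided (lTensorOp M (mulR (antipodePow k H n))) (lTensorOp M (mulL LinearMap.id))
      (orbit (rTensorOp H act.toLinearMap) z) :=
  orbit_twist LinearMap.id _ _ _ (fun _ _ _ => mapBilinear_sandwich _ _ _) z

theorem orbit_postOp_twistHom {X : Type*} [AddCommGroup X] [Module k X]
    (θ : X →ₗ[k] (H →ₗ[k] M)) : orbit (postOp X (twistHom act n)) θ =
      twoSided (postOp X (preOp M (mulR (antipodePow k H n))))
        (postOp X (preOp M (mulL (HopfAlgebra.antipode k))))
        (orbit (postOp X (postOp H act.toLinearMap)) θ) :=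
  orbit_twist (Φ := conjHom k H M) (LinearMap.llcomp k X _ _) _ _ _
    (fun _ _ _ => by rw [conjHom_sandwich]; rfl) θ

theorem orbit_postOp_twistMH {X : Type*} [AddCommGroup X] [Module k X] (f : X →ₗ[k] M ⊗[k] H) :
    orbit (postOp X (twistMH act n)) f =
      twoSided (postOp X (lTensorOp M (mulR (antipodePow k H n))))
        (postOp X (lTensorOp M (mulL LinearMap.id)))
        (orbit (postOp X (rTensorOp H act.toLinearMap)) f) :=
  orbit_twist (Φ := TensorProduct.mapBilinear (RingHom.id k) M H M H)
    (LinearMap.llcomp k X _ _) _ _ _ (fun _ _ _ => by rw [mapBilinear_sandwich]; rfl) f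

theorem orbit_lTensorOp_twistHom {X : Type*} [AddCommGroup X] [Module k X]
    (z : X ⊗[k] (H →ₗ[k] M)) : orbit (lTensorOp X (twistHom act n)) z =
      twoSided (lTensorOp X (preOp M (mulR (antipodePow k H n))))
        (lTensorOp X (preOp M (mulL (HopfAlgebra.antipode k))))
        (orbit (lTensorOp X (postOp H act.toLinearMap)) z) :=
  orbit_twist (Φ := conjHom k H M) (LinearMap.lTensorHom X) _ _ _
    (fun _ _ _ => by
      rw [conjHom_sandwich, LinearMap.coe_lTensorHom, LinearMap.lTensor_comp,
        LinearMap.lTensor_comp]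
      rfl) z

theorem orbit_rTensorOp_twistHM {X : Type*} [AddCommGroup X] [Module k X]
    (z : (H ⊗[k] M) ⊗[k] X) : orbit (rTensorOp X (twistHM act n)) z =
      twoSided (rTensorOp X (rTensorOp M (mulR (antipodePow k H n))))
        (rTensorOp X (rTensorOp M (mulL LinearMap.id)))
        (orbit (rTensorOp X (lTensorOp H act.toLinearMap)) z) :=
  orbit_twist (Φ := endMapHM k H M) (LinearMap.rTensorHom X) _ _ _
    (fun _ _ _ => by
      rw [endMapHM_sandwich, LinearMap.coe_rTensorHom, LinearMap.rTensor_comp,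
        LinearMap.rTensor_comp]
      rfl) z

end TwistFormulas

/-! ### Stability of M̂ and equivariance of its contraaction. -/

section Hat

variable {k : Type u} {H : Type v} [Field k] [Ring H] [HopfAlgebra k H]
  {M : Type w} [AddCommGroup M] [Module k M]

/-- This and the next three lemmas turn operators around f ⊗ id into multiplication by a simple
tensor, the form in which the identities in H ⊗ H apply. -/
theorem lTensor_mulRight_rTensor (f : H →ₗ[k] M) (b : H) (z : H ⊗[k] H) :
    (LinearMap.mulRight k b).lTensor M (f.rTensor H z) = f.rTensor H (z * (1 ⊗ₜ b)) := by
  induction z with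
  | zero => simp
  | add x y hx hy => simp only [map_add, add_mul, hx, hy]
  | tmul x y => simp

theorem lTensor_mulLeft_rTensor (f : H →ₗ[k] M) (b : H) (z : H ⊗[k] H) :
    (LinearMap.mulLeft k b).lTensor M (f.rTensor H z) = f.rTensor H ((1 ⊗ₜ b) * z) := by
  induction z with
  | zero => simp
  | add x y hx hy => simp only [map_add, mul_add, hx, hy]
  | tmul x y => simp

theorem rTensor_comp_mulRight (f : H →ₗ[k] M) (b : H) (z : H ⊗[k] H) :
    (f ∘ₗ LinearMap.mulRight k b).rTensor H z = f.rTensor H (z * (b ⊗ₜ 1)) := by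
  induction z with
  | zero => simp
  | add x y hx hy => simp only [map_add, add_mul, hx, hy]
  | tmul x y => simp

theorem rTensor_comp_mulLeft (f : H →ₗ[k] M) (b : H) (z : H ⊗[k] H) :
    (f ∘ₗ LinearMap.mulLeft k b).rTensor H z = f.rTensor H ((b ⊗ₜ 1) * z) := by
  induction z with
  | zero => simp
  | add x y hx hy => simp only [map_add, mul_add, hx, hy]
  | tmul x y => simp

/-- The map `f ↦ (h ↦ ∑ f(h¹) ⊗ h²)`. -/
noncomputable def coextend : (H →ₗ[k] M) →ₗ[k] (H →ₗ[k] M ⊗[k] H) :=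
  LinearMap.lcomp k (M ⊗[k] H) Coalgebra.comul ∘ₗ LinearMap.rTensorHom H

@[simp] theorem coextend_apply (f : H →ₗ[k] M) (h : H) :
    coextend f h = f.rTensor H (Coalgebra.comul h) := rfl

/-- The map `θ ↦ (h ↦ ∑ θ_{h¹}(h²))`. -/
noncomputable def diagonal : (H →ₗ[k] (H →ₗ[k] M)) →ₗ[k] (H →ₗ[k] M) :=
  LinearMap.lcomp k M Coalgebra.comul ∘ₗ
    (TensorProduct.lift.equiv (RingHom.id k) H H M).toLinearMap

theorem diagonal_apply (θ : H →ₗ[k] (H →ₗ[k] M)) (h : H) :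
    diagonal θ h = TensorProduct.lift θ (Coalgebra.comul h) := rfl

theorem lift_mul_tmul (θ : H →ₗ[k] (H →ₗ[k] M)) (a b : H) (z : H ⊗[k] H) :
    TensorProduct.lift ((LinearMap.llcomp k H H M).flip (LinearMap.mulRight k b) ∘ₗ θ ∘ₗ
      LinearMap.mulRight k a) z = TensorProduct.lift θ (z * (a ⊗ₜ b)) := by
  induction z with
  | zero => simp
  | add x y hx hy => simp only [map_add, add_mul, hx, hy]
  | tmul x y => simp

theorem lift_tmul_mul (θ : H →ₗ[k] (H →ₗ[k] M)) (a b : H) (z : H ⊗[k] H) :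
    TensorProduct.lift ((LinearMap.llcomp k H H M).flip (LinearMap.mulLeft k b) ∘ₗ θ ∘ₗ
      LinearMap.mulLeft k a) z = TensorProduct.lift θ ((a ⊗ₜ b) * z) := by
  induction z with
  | zero => simp
  | add x y hx hy => simp only [map_add, mul_add, hx, hy]
  | tmul x y => simp

variable [BijectiveAntipode k H]

theorem twistHom_mem_hat {C : RightComodule k H M} {act : H →ₐ[k] Module.End k M} {n : ℤ}
    (hn : Even n) (hρ : ∀ h m, C.coact (act h m) = twistMH act (n + 1) h (C.coact m)) (h : H)
    {f : H →ₗ[k] M} (hf : f ∈ hat C) : twistHom act n h f ∈ hat C := by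
  have hf' : C.coact ∘ₗ f = coextend f := LinearMap.ext hf
  -- The Yetter–Drinfeld law for M, together with colinearity of f, turns ρ(a f(x)) into the twisted
  -- action of a on f(x¹) ⊗ x².
  have h₁ : LinearMap.compRight k C.coact ∘ₗ orbit (postOp H act.toLinearMap) f =
      orbit (postOp H (twistMH act (n + 1))) (coextend f) := by
    rw [← hf']
    ext a x
    simp [hρ]
  have h₂ : orbit (postOp H (rTensorOp H act.toLinearMap)) (coextend f) =
      coextend ∘ₗ orbit (postOp H act.toLinearMap) f := by
    ext a x
    simp [LinearMap.rTensor_comp]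
  have key : LinearMap.compRight k C.coact ∘ₗ orbit (twistHom act n) f =
      coextend ∘ₗ orbit (twistHom act n) f := by
    rw [orbit_twistHom, map_twoSided (u' := preOp _ (mulR (antipodePow k H n)))
      (v' := preOp _ (mulL (HopfAlgebra.antipode k))) _ _ (fun _ _ => rfl) (fun _ _ => rfl),
      h₁, orbit_postOp_twistMH, twoSided_twoSided _ (fun _ _ _ => rfl), h₂]
    refine (map_twoSided _ _ (fun b g => ?_) (fun b g => ?_)).symm
    · ext x
      -- Right end: Δ(S^n(h¹))(1 ⊗ S^{n+1}(h²)) = S^n(h) ⊗ 1.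
      have h₃ := map_convEnd_convT (LinearMap.applyₗ x)
        (g.rTensor H ∘ₗ LinearMap.mulLeft k (Coalgebra.comul x))
        (u := preOp _ (mulR (antipodePow k H n)))
        (u' := postOp _ (lTensorOp M (mulR (antipodePow k H (n + 1))))) (x := coextend g)
        (f := Coalgebra.comul ∘ₗ antipodePow k H n)
        (g := inr k H ∘ₗ antipodePow k H (n + 1))
        (fun a c => by simp [mulR_eq, lTensor_mulRight_rTensor, mul_assoc]) b
      rw [comul_antipodePow_convT_inr hn] at h₃
      exact (rTensor_comp_mulRight g _ _).trans h₃.symm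
    · ext x
      -- Left end: (1 ⊗ h¹)Δ(S(h²)) = S(h) ⊗ 1.
      have h₃ := map_convEndOp_convT (LinearMap.applyₗ x)
        (g.rTensor H ∘ₗ LinearMap.mulRight k (Coalgebra.comul x))
        (u := postOp _ (lTensorOp M (mulL LinearMap.id)))
        (u' := preOp _ (mulL (HopfAlgebra.antipode k))) (x := coextend g)
        (f := inr k H ∘ₗ LinearMap.id)
        (g := Coalgebra.comul ∘ₗ HopfAlgebra.antipode k)
        (fun a c => by simp [mulL_eq, lTensor_mulLeft_rTensor, mul_assoc]) b
      rw [inr_convT_comul_antipode] at h₃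
      exact (rTensor_comp_mulLeft g _ _).trans h₃.symm
  intro x
  exact LinearMap.congr_fun (LinearMap.congr_fun key h) x

theorem diagonal_twistHom {act : H →ₐ[k] Module.End k M} {n : ℤ} (hn : Even n) (h : H)
    (θ : H →ₗ[k] (H →ₗ[k] M)) :
    diagonal (twistHom (homAct act hn) n h θ) = twistHom act n h (diagonal θ) := by
  have h₁ : orbit (postOp H (homAct act hn).toLinearMap) θ =
      orbit (postOp H (twistHom act n)) θ := rfl
  have h₂ : diagonal ∘ₗ orbit (postOp H (postOp H act.toLinearMap)) θ =
      orbit (postOp H act.toLinearMap) (diagonal θ) := by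
    ext a x
    simp only [LinearMap.comp_apply, orbit_apply, diagonal_apply, postOp_apply]
    generalize Coalgebra.comul (R := k) x = z
    induction z with
    | zero => simp
    | add x y hx hy => simp only [map_add, hx, hy]
    | tmul x y => simp
  have key : diagonal ∘ₗ orbit (twistHom (homAct act hn) n) θ =
      orbit (twistHom act n) (diagonal θ) := by
    rw [orbit_twistHom, h₁, orbit_postOp_twistHom, twoSided_twoSided _ (fun _ _ _ => rfl),
      orbit_twistHom, ← h₂]
    refine map_twoSided _ _ (fun b g => ?_) (fun b g => ?_)
    · ext x
      -- Right end: S^n(h¹) ⊗ S^n(h²) = Δ(S^n(h)). The left end below uses S(h²) ⊗ S(h¹) = Δ(S(h))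
      -- in the same way.
      have h₃ := map_convEnd_convT (LinearMap.applyₗ x ∘ₗ diagonal)
        (TensorProduct.lift g ∘ₗ LinearMap.mulLeft k (Coalgebra.comul x))
        (u := preOp _ (mulR (antipodePow k H n)))
        (u' := postOp _ (preOp M (mulR (antipodePow k H n)))) (x := g)
        (f := inl k H ∘ₗ antipodePow k H n) (g := inr k H ∘ₗ antipodePow k H n)
        (fun a c => (lift_mul_tmul g (antipodePow k H n a) (antipodePow k H n c) _).trans
          (by simp)) b
      rw [← comul_comp_antipodePow hn] at h₃
      exact h₃.trans (congrArg _ (Bialgebra.comul_mul _ _).symm)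
    · ext x
      have h₃ := map_convEndOp_convT (LinearMap.applyₗ x ∘ₗ diagonal)
        (TensorProduct.lift g ∘ₗ LinearMap.mulRight k (Coalgebra.comul x))
        (u := postOp _ (preOp M (mulL (HopfAlgebra.antipode k))))
        (u' := preOp _ (mulL (HopfAlgebra.antipode k))) (x := g)
        (f := inr k H ∘ₗ HopfAlgebra.antipode k) (g := inl k H ∘ₗ HopfAlgebra.antipode k)
        (fun a c => (lift_tmul_mul g (HopfAlgebra.antipode k c) (HopfAlgebra.antipode k a) _).trans
          (by simp)) b
      rw [← comul_comp_antipode] at h₃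
      exact h₃.trans (congrArg _ (Bialgebra.comul_mul _ _).symm)
  exact LinearMap.congr_fun key h

end Hat

/-! ### H-linearity across the tensor-hom correspondence. -/

section Adjunction

variable {k : Type u} {H : Type v} [Field k] [Ring H] [HopfAlgebra k H] [BijectiveAntipode k H]
  {M : Type w} [AddCommGroup M] [Module k M]

/-- After merging, the right end multiplies by S^n(h¹)S^{n+1}(h²) and the left end by h¹S(h²). Both
are ε(h), and the counit removes the outer legs. The companion lemma uses the inverses on the other
side. -/
theorem twoSided_twistHom_cancel {n : ℤ} (hn : Even n) (m : H →ₗ[k] (H →ₗ[k] M)) :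
    twoSided (preOp M (mulR (antipodePow k H n))) (preOp M (mulL (HopfAlgebra.antipode k)))
      (twoSided (preOp M (mulR (antipodePow k H (n + 1)))) (preOp M (mulL LinearMap.id)) m) =
      m := by
  rw [twoSided_twoSided _ (fun a c f => by ext; simp [mul_assoc])]
  refine twoSided_counit _ (fun h f => ?_) (fun h f => ?_)
  · ext x
    refine (conv_congr (LinearMap.applyₗ x ∘ₗ LinearMap.applyₗ f)
      (f ∘ₗ LinearMap.mulLeft k x) (c' := LinearMap.mul k H) (f' := antipodePow k H n)
      (g' := antipodePow k H (n + 1)) (fun a b => by simp [mul_assoc]) h).trans ?_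
    rw [conv_antipodePow_mul hn]
    simp [Algebra.algebraMap_eq_smul_one]
  · ext x
    refine (conv_congr (LinearMap.applyₗ x ∘ₗ LinearMap.applyₗ f)
      (f ∘ₗ LinearMap.mulRight k x) (c' := LinearMap.mul k H) (f' := LinearMap.id)
      (g' := HopfAlgebra.antipode k) (fun a b => by simp [mul_assoc]) h).trans ?_
    rw [conv_mul_antipode]
    simp [Algebra.algebraMap_eq_smul_one]

theorem twoSided_twistHM_cancel {n : ℤ} (hn : Even n) (m : H →ₗ[k] (H →ₗ[k] M)) :
    twoSided (preOp M (mulR (antipodePow k H (n + 1)))) (preOp M (mulL LinearMap.id))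
      (twoSided (preOp M (mulR (antipodePow k H n))) (preOp M (mulL (HopfAlgebra.antipode k))) m) =
      m := by
  rw [twoSided_twoSided _ (fun a c f => by ext; simp [mul_assoc])]
  refine twoSided_counit _ (fun h f => ?_) (fun h f => ?_)
  · ext x
    refine (conv_congr (LinearMap.applyₗ x ∘ₗ LinearMap.applyₗ f)
      (f ∘ₗ LinearMap.mulLeft k x) (c' := LinearMap.mul k H) (f' := antipodePow k H (n + 1))
      (g' := antipodePow k H n) (fun a b => by simp [mul_assoc]) h).trans ?_
    rw [conv_antipodePow_add_one_mul hn]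
    simp [Algebra.algebraMap_eq_smul_one]
  · ext x
    refine (conv_congr (LinearMap.applyₗ x ∘ₗ LinearMap.applyₗ f)
      (f ∘ₗ LinearMap.mulRight k x) (c' := LinearMap.mul k H) (f' := HopfAlgebra.antipode k)
      (g' := LinearMap.id) (fun a b => by simp [mul_assoc]) h).trans ?_
    rw [conv_antipode_mul]
    simp [Algebra.algebraMap_eq_smul_one]

variable {N : Type w} [AddCommGroup N] [Module k N]

/-- Pulling the twisted action on `H ⊗ N` back along `F : H ⊗ N → M`. -/
theorem comp_twistHM (actN : H →ₐ[k] Module.End k N) (n : ℤ) (G : N →ₗ[k] (H →ₗ[k] M)) (y : N) :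
    (LinearMap.llcomp k H (H ⊗[k] N) M (TensorProduct.lift G.flip) ∘ₗ
      (LinearMap.llcomp k H (H ⊗[k] N) (H ⊗[k] N)).flip ((TensorProduct.mk k H N).flip y)) ∘ₗ
        twistHM actN n =
      twoSided (preOp M (mulR (antipodePow k H n))) (preOp M (mulL LinearMap.id))
        (G ∘ₗ orbit actN.toLinearMap y) :=
  map_twist (Φ := endMapHM k H N) _ _ _ _ fun a b c => by
    rw [endMapHM_sandwich]
    ext x
    simp [mul_assoc]

/-- A linear map `H ⊗ N → M` is `H`-linear for the twisted action on `H ⊗ N` if and only if the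
corresponding map `N → Hom(H, M)` is `H`-linear for the twisted action on `Hom(H, M)`. -/
theorem lift_twistHM_iff (actM : H →ₐ[k] Module.End k M) (actN : H →ₐ[k] Module.End k N) {n : ℤ}
    (hn : Even n) (G : N →ₗ[k] (H →ₗ[k] M)) :
    (∀ h z, TensorProduct.lift G.flip (twistHM actN (n + 1) h z) =
      actM h (TensorProduct.lift G.flip z)) ↔
    ∀ h y, G (actN h y) = twistHom actM n h (G y) := by
  constructor
  · intro hF h y
    -- H-linearity of F says that h ↦ h ∘ G(y) is the (S^{n+1}, id)-twist of h ↦ G(hy). Twisting by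
    -- (S^n, S) inverts this relation and isolates G(hy).
    have h₁ : orbit (postOp H actM.toLinearMap) (G y) =
        twoSided (preOp M (mulR (antipodePow k H (n + 1)))) (preOp M (mulL LinearMap.id))
          (G ∘ₗ orbit actN.toLinearMap y) := by
      rw [← comp_twistHM]
      ext a x
      simpa using (hF a (x ⊗ₜ y)).symm
    have h₂ := orbit_twistHom actM n (G y)
    rw [h₁, twoSided_twistHom_cancel hn] at h₂
    exact (LinearMap.congr_fun h₂ h).symm
  · intro hG h z
    induction z with
    | zero => simp
    | add x y hx hy => simp only [map_add, hx, hy]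
    | tmul x y =>
      have h₁ : G ∘ₗ orbit actN.toLinearMap y =
          twoSided (preOp M (mulR (antipodePow k H n))) (preOp M (mulL (HopfAlgebra.antipode k)))
            (orbit (postOp H actM.toLinearMap) (G y)) := by
        rw [← orbit_twistHom]
        ext1 a
        exact hG a y
      have h₂ := comp_twistHM (n := n + 1) actN G y
      rw [h₁, twoSided_twistHM_cancel hn] at h₂
      simpa using LinearMap.congr_fun (LinearMap.congr_fun h₂ h) x

end Adjunction

/-! ### Equivariance of the relations and of the coaction on H ⊗ N. -/

section PrimeOperators

variable {k : Type u} {H : Type v} [Field k] [Ring H] [HopfAlgebra k H]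
  {N : Type w} [AddCommGroup N] [Module k N]

theorem rTensor_comm {X Y : Type*} [AddCommGroup X] [Module k X] [AddCommGroup Y] [Module k Y]
    (g : Module.End k Y) (z : X ⊗[k] Y) :
    g.rTensor X (TensorProduct.comm k X Y z) = TensorProduct.comm k X Y (g.lTensor X z) := by
  induction z with
  | zero => simp
  | add x y hx hy => simp only [map_add, hx, hy]
  | tmul x y => simp

theorem lTensor_rTensor_comm {X Y : Type*} [AddCommGroup X] [Module k X] [AddCommGroup Y]
    [Module k Y] (g : Module.End k X) (f : Module.End k Y) (z : X ⊗[k] Y) :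
    f.lTensor X (g.rTensor Y z) = g.rTensor Y (f.lTensor X z) := by
  induction z with
  | zero => simp
  | add x y hx hy => simp only [map_add, hx, hy]
  | tmul x y => simp

@[simp] theorem evalMap_tmul (x : H) (f : H →ₗ[k] N) : evalMap k H N (x ⊗ₜ f) =
    TensorProduct.comm k N H (f.rTensor H (Coalgebra.comul x)) := rfl

/-- The map `z ↦ ∑ (z¹ ⊗ n) ⊗ z²` on `H ⊗ H`. -/
noncomputable def insertMid (n : N) : H ⊗[k] H →ₗ[k] (H ⊗[k] N) ⊗[k] H :=
  ((TensorProduct.mk k H N).flip n).rTensor H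

theorem primeCoact_tmul (x : H) (n : N) :
    primeCoact k H N (x ⊗ₜ n) = insertMid n (Coalgebra.comul x) := by
  simp only [primeCoact, insertMid, LinearMap.comp_apply, LinearMap.rTensor_tmul]
  generalize Coalgebra.comul (R := k) x = t
  induction t with
  | zero => simp
  | add x y hx hy => simp only [map_add, TensorProduct.add_tmul, hx, hy]
  | tmul x y => simp

theorem insertMid_mul_tmul (n : N) (a b : H) (z : H ⊗[k] H) :
    (LinearMap.mulRight k b).lTensor (H ⊗[k] N)
      (((LinearMap.mulRight k a).rTensor N).rTensor H (insertMid n z)) =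
      insertMid n (z * (a ⊗ₜ b)) := by
  induction z with
  | zero => simp
  | add x y hx hy => simp only [map_add, add_mul, hx, hy]
  | tmul x y => simp [insertMid]

theorem insertMid_tmul_mul (n : N) (a b : H) (z : H ⊗[k] H) :
    (LinearMap.mulLeft k b).lTensor (H ⊗[k] N)
      (((LinearMap.mulLeft k a).rTensor N).rTensor H (insertMid n z)) =
      insertMid n ((a ⊗ₜ b) * z) := by
  induction z with
  | zero => simp
  | add x y hx hy => simp only [map_add, mul_add, hx, hy]
  | tmul x y => simp [insertMid]

variable [BijectiveAntipode k H]

theorem evalMap_twistHM {act : H →ₐ[k] Module.End k N} {n : ℤ} (hn : Even n) (h : H)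
    (z : H ⊗[k] (H →ₗ[k] N)) :
    evalMap k H N (twistHM (homAct act hn) (n + 1) h z) =
      twistHM act (n + 1) h (evalMap k H N z) := by
  have h₁ : orbit (lTensorOp H (homAct act hn).toLinearMap) z =
      orbit (lTensorOp H (twistHom act n)) z := rfl
  have h₂ : evalMap k H N ∘ₗ orbit (lTensorOp H (postOp H act.toLinearMap)) z =
      orbit (lTensorOp H act.toLinearMap) (evalMap k H N z) := by
    ext a
    induction z with
    | zero => simp
    | add x y hx hy =>
      simp only [LinearMap.comp_apply, orbit_apply, map_add] at hx hy ⊢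
      -- `h₁` mentions `z`, so the induction makes it a premise of each hypothesis; `rfl` discharges
      -- it.
      rw [hx rfl, hy rfl]
    | tmul x f =>
      simp only [LinearMap.comp_apply, orbit_apply, lTensorOp_apply, LinearMap.lTensor_tmul,
        evalMap_tmul]
      generalize Coalgebra.comul (R := k) x = t
      induction t with
      | zero => simp
      | add x y hx hy => simp only [map_add, hx, hy]
      | tmul x y => simp
  have key : evalMap k H N ∘ₗ orbit (twistHM (homAct act hn) (n + 1)) z =
      orbit (twistHM act (n + 1)) (evalMap k H N z) := by
    rw [orbit_twistHM, h₁, orbit_lTensorOp_twistHom,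
      twoSided_twoSided _ (fun _ _ _ => lTensor_rTensor_comm _ _ _), orbit_twistHM, ← h₂]
    refine map_twoSided _ _ (fun b g => ?_) (fun b g => ?_)
    · induction g with
      | zero => simp
      | add x y hx hy => simp only [map_add, hx, hy]
      | tmul x f =>
        -- Right end: Δ(S^{n+1}(h¹))(S^n(h²) ⊗ 1) = 1 ⊗ S^{n+1}(h). The surviving leg is the one
        -- `evalMap` leaves outside f.
        have h₃ := map_convEnd_convT (evalMap k H N)
          ((TensorProduct.comm k N H).toLinearMap ∘ₗ f.rTensor H ∘ₗ
            LinearMap.mulLeft k (Coalgebra.comul x))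
          (u := rTensorOp _ (mulR (antipodePow k H (n + 1))))
          (u' := lTensorOp H (preOp N (mulR (antipodePow k H n)))) (x := x ⊗ₜ f)
          (f := Coalgebra.comul ∘ₗ antipodePow k H (n + 1))
          (g := inl k H ∘ₗ antipodePow k H n)
          (fun a c => by simp [mulR_eq, rTensor_comp_mulRight, mul_assoc]) b
        rw [comul_antipodePow_add_one_convT_inl hn] at h₃
        refine h₃.trans ?_
        simp [mulR_eq, rTensor_comm, lTensor_mulRight_rTensor]
    · induction g with
      | zero => simp
      | add x y hx hy => simp only [map_add, hx, hy]
      | tmul x f =>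
        -- Left end: (S(h¹) ⊗ 1)Δ(h²) = 1 ⊗ h.
        have h₃ := map_convEndOp_convT (evalMap k H N)
          ((TensorProduct.comm k N H).toLinearMap ∘ₗ f.rTensor H ∘ₗ
            LinearMap.mulRight k (Coalgebra.comul x))
          (u := lTensorOp H (preOp N (mulL (HopfAlgebra.antipode k))))
          (u' := rTensorOp _ (mulL LinearMap.id)) (x := x ⊗ₜ f)
          (f := inl k H ∘ₗ HopfAlgebra.antipode k) (g := Coalgebra.comul)
          (fun a c => by simp [mulL_eq, rTensor_comp_mulLeft, mul_assoc]) b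
        rw [inl_antipode_convT_comul] at h₃
        refine h₃.trans ?_
        simp [mulL_eq, rTensor_comm, lTensor_mulLeft_rTensor]
  exact LinearMap.congr_fun key h

theorem primeCoact_twistHM {act : H →ₐ[k] Module.End k N} {n : ℤ} (hn : Even n) (h : H)
    (z : H ⊗[k] N) : primeCoact k H N (twistHM act (n + 1) h z) =
      twistMH (tensorAct act hn) (n + 1) h (primeCoact k H N z) := by
  have h₁ : orbit (rTensorOp H (tensorAct act hn).toLinearMap) (primeCoact k H N z) =
      orbit (rTensorOp H (twistHM act (n + 1))) (primeCoact k H N z) := rfl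
  have h₂ : orbit (rTensorOp H (lTensorOp H act.toLinearMap)) (primeCoact k H N z) =
      primeCoact k H N ∘ₗ orbit (lTensorOp H act.toLinearMap) z := by
    ext a
    induction z with
    | zero => simp
    | add x y hx hy =>
      simp only [LinearMap.comp_apply, orbit_apply, map_add] at hx hy ⊢
      rw [hx rfl, hy rfl]
    | tmul x f =>
      simp only [LinearMap.comp_apply, orbit_apply, lTensorOp_apply, rTensorOp_apply,
        LinearMap.lTensor_tmul, primeCoact_tmul]
      generalize Coalgebra.comul (R := k) x = t
      induction t with
      | zero => simp
      | add x y hx hy => simp only [map_add, hx, hy]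
      | tmul x y => simp [insertMid]
  have key : primeCoact k H N ∘ₗ orbit (twistHM act (n + 1)) z =
      orbit (twistMH (tensorAct act hn) (n + 1)) (primeCoact k H N z) := by
    rw [orbit_twistMH, h₁, orbit_rTensorOp_twistHM,
      twoSided_twoSided, orbit_twistHM, h₂]
    swap
    · exact fun a c x => Eq.symm (lTensor_rTensor_comm
        (rTensorOp N (mulR (antipodePow k H (n + 1))) a) (mulL LinearMap.id c) x)
    refine map_twoSided (H := H) (E := H ⊗[k] N) (E' := (H ⊗[k] N) ⊗[k] H) (primeCoact k H N) _ (fun b g => ?_) (fun b g => ?_)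
    · induction g with
      | zero => simp
      | add x y hx hy => simp only [map_add, hx, hy]
      | tmul x f =>
        -- Right end: (1 ⊗ S^{n+1}(h¹))(S^{n+1}(h²) ⊗ 1) = Δ(S^{n+1}(h)), as S^{n+1} reverses the
        -- coproduct. The left end is just Δ(h) = h¹ ⊗ h².
        have h₃ := map_convEnd_convT (E := (H ⊗[k] N) ⊗[k] H) LinearMap.id
          (insertMid f ∘ₗ LinearMap.mulLeft k (Coalgebra.comul x))
          (u := lTensorOp _ (mulR (antipodePow k H (n + 1))))
          (u' := rTensorOp H (rTensorOp N (mulR (antipodePow k H (n + 1)))))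
          (x := primeCoact k H N (x ⊗ₜ f))
          (f := inr k H ∘ₗ antipodePow k H (n + 1)) (g := inl k H ∘ₗ antipodePow k H (n + 1))
          (fun a c => by simp [mulR_eq, primeCoact_tmul, insertMid_mul_tmul]) b
        rw [← comul_comp_antipodePow_add_one hn] at h₃
        refine Eq.trans ?_ h₃.symm
        simp [primeCoact_tmul]
    · induction g with
      | zero => simp
      | add x y hx hy => simp only [map_add, hx, hy]
      | tmul x f =>
        have h₃ := map_convEndOp_convT (E := (H ⊗[k] N) ⊗[k] H) LinearMap.id
          (insertMid f ∘ₗ LinearMap.mulRight k (Coalgebra.comul x))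
          (u := rTensorOp H (rTensorOp N (mulL LinearMap.id)))
          (u' := lTensorOp _ (mulL LinearMap.id))
          (x := primeCoact k H N (x ⊗ₜ f))
          (f := inl k H ∘ₗ LinearMap.id) (g := inr k H ∘ₗ LinearMap.id)
          (fun a c => by simp [mulL_eq, primeCoact_tmul, insertMid_tmul_mul]) b
        rw [← comul_eq_convT] at h₃
        refine Eq.trans ?_ h₃.symm
        simp [primeCoact_tmul]
  exact LinearMap.congr_fun key h

end PrimeOperators

/-! ### The comodule structure on the quotient N'. -/

section PrimeStructure

variable {k : Type u} {H : Type v} [Field k] [Ring H] [HopfAlgebra k H]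
  {N : Type w} [AddCommGroup N] [Module k N]

theorem primeMk_contra (C : RightContramodule k H N) (z : H ⊗[k] (H →ₗ[k] N)) :
    primeMk C (C.contra.lTensor H z) = primeMk C (evalMap k H N z) :=
  (Submodule.Quotient.eq _).2 ⟨z, rfl⟩

/-- To descend to `N'` it suffices to agree on `h ⊗ α(f)` and `h² ⊗ f(h¹)`. -/
noncomputable def primeLift (C : RightContramodule k H N) {P : Type*} [AddCommGroup P] [Module k P]
    (F : H ⊗[k] N →ₗ[k] P) (hF : ∀ z, F (C.contra.lTensor H z) = F (evalMap k H N z)) :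
    Prime C →ₗ[k] P :=
  Submodule.liftQ _ F (by
    rintro _ ⟨z, rfl⟩
    simp [hF])

theorem primeCoact_contra (C : RightContramodule k H N) (z : H ⊗[k] (H →ₗ[k] N)) :
    primeCoact k H N (C.contra.lTensor H z) =
      (C.contra.lTensor H).rTensor H (primeCoact k H (H →ₗ[k] N) z) := by
  induction z with
  | zero => simp
  | add x y hx hy => simp only [map_add, hx, hy]
  | tmul x f =>
    simp only [LinearMap.lTensor_tmul, primeCoact_tmul]
    generalize Coalgebra.comul (R := k) x = t
    induction t with
    | zero => simp
    | add x y hx hy => simp only [map_add, hx, hy]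
    | tmul x y => simp [insertMid]

/-- By coassociativity both sides send h ⊗ f to (h² ⊗ f(h¹)) ⊗ h³. With `primeCoact_contra` this
makes the coaction respect the relations of N'. -/
theorem primeCoact_evalMap (z : H ⊗[k] (H →ₗ[k] N)) :
    primeCoact k H N (evalMap k H N z) =
      (evalMap k H N).rTensor H (primeCoact k H (H →ₗ[k] N) z) := by
  induction z with
  | zero => simp
  | add x y hx hy => simp only [map_add, hx, hy]
  | tmul x f =>
    have h₁ : ∀ t : H ⊗[k] H, primeCoact k H N (TensorProduct.comm k N H (f.rTensor H t)) =
        ((TensorProduct.comm k N H).toLinearMap ∘ₗ f.rTensor H).rTensor H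
          ((TensorProduct.assoc k H H H).symm ((Coalgebra.comul (R := k)).lTensor H t)) := by
      intro t
      induction t with
      | zero => simp
      | add x y hx hy => simp only [map_add, hx, hy]
      | tmul a b =>
        simp only [LinearMap.rTensor_tmul, TensorProduct.comm_tmul, primeCoact_tmul,
          LinearMap.lTensor_tmul]
        generalize Coalgebra.comul (R := k) b = t
        induction t with
        | zero => simp
        | add x y hx hy => simp only [map_add, TensorProduct.tmul_add, hx, hy]
        | tmul x y => simp [insertMid]
    rw [evalMap_tmul, h₁, Coalgebra.coassoc_symm_apply, primeCoact_tmul]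
    generalize Coalgebra.comul (R := k) x = t
    induction t with
    | zero => simp
    | add x y hx hy => simp only [map_add, hx, hy]
    | tmul x y => simp [insertMid]

theorem primeCoact_coassoc (z : H ⊗[k] N) :
    TensorProduct.assoc k (H ⊗[k] N) H H
      ((primeCoact k H N).rTensor H (primeCoact k H N z)) =
      (Coalgebra.comul (R := k)).lTensor (H ⊗[k] N) (primeCoact k H N z) := by
  induction z with
  | zero => simp
  | add x y hx hy => simp only [map_add, hx, hy]
  | tmul x n =>
    have h₁ : ∀ t : H ⊗[k] H, (primeCoact k H N).rTensor H (insertMid n t) =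
        (insertMid n).rTensor H ((Coalgebra.comul (R := k)).rTensor H t) := by
      intro t
      induction t with
      | zero => simp
      | add x y hx hy => simp only [map_add, hx, hy]
      | tmul a b =>
        simp [insertMid, primeCoact_tmul]
    have h₂ : ∀ t : H ⊗[k] H, (Coalgebra.comul (R := k)).lTensor (H ⊗[k] N) (insertMid n t) =
        ((TensorProduct.mk k H N).flip n).rTensor (H ⊗[k] H)
          ((Coalgebra.comul (R := k)).lTensor H t) := by
      intro t
      induction t with
      | zero => simp
      | add x y hx hy => simp only [map_add, hx, hy]
      | tmul a b => simp [insertMid]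
    rw [primeCoact_tmul, h₁, h₂, ← Coalgebra.coassoc_apply]
    generalize (Coalgebra.comul (R := k)).rTensor H (Coalgebra.comul x) = t
    induction t with
    | zero => simp
    | add x y hx hy => simp only [map_add, hx, hy]
    | tmul t z =>
      induction t with
      | zero => simp
      | add x y hx hy => simp only [map_add, TensorProduct.add_tmul, hx, hy]
      | tmul x y => simp [insertMid]

theorem primeCoact_counit (z : H ⊗[k] N) :
    TensorProduct.rid k (H ⊗[k] N)
      ((Coalgebra.counit (R := k) (A := H)).lTensor (H ⊗[k] N) (primeCoact k H N z)) = z := by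
  induction z with
  | zero => simp
  | add x y hx hy => simp only [map_add, hx, hy]
  | tmul x n =>
    have h₁ : ∀ t : H ⊗[k] H, TensorProduct.rid k (H ⊗[k] N)
        ((Coalgebra.counit (R := k) (A := H)).lTensor (H ⊗[k] N) (insertMid n t)) =
        TensorProduct.rid k H ((Coalgebra.counit (R := k) (A := H)).lTensor H t) ⊗ₜ n := by
      intro t
      induction t with
      | zero => simp
      | add x y hx hy => simp only [map_add, TensorProduct.add_tmul, hx, hy]
      | tmul a b => simp [insertMid, TensorProduct.smul_tmul']
    rw [primeCoact_tmul, h₁]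
    simp

/-- The coaction `h ⊗ n ↦ (h¹ ⊗ n) ⊗ h²` on `N'`. -/
noncomputable def primeCoaction (C : RightContramodule k H N) : Prime C →ₗ[k] Prime C ⊗[k] H :=
  primeLift C ((primeMk C).rTensor H ∘ₗ primeCoact k H N) (fun z => by
    have h₁ : primeMk C ∘ₗ C.contra.lTensor H = primeMk C ∘ₗ evalMap k H N :=
      LinearMap.ext (primeMk_contra C)
    rw [LinearMap.comp_apply, LinearMap.comp_apply, primeCoact_contra, primeCoact_evalMap,
      ← LinearMap.comp_apply, ← LinearMap.rTensor_comp, h₁, LinearMap.rTensor_comp,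
      LinearMap.comp_apply])

theorem primeCoaction_mk (C : RightContramodule k H N) (z : H ⊗[k] N) :
    primeCoaction C (primeMk C z) = (primeMk C).rTensor H (primeCoact k H N z) := rfl

theorem primeCoaction_coassoc (C : RightContramodule k H N) (x : Prime C) :
    TensorProduct.assoc k (Prime C) H H ((primeCoaction C).rTensor H (primeCoaction C x)) =
      (Coalgebra.comul (R := k) (A := H)).lTensor (Prime C) (primeCoaction C x) := by
  obtain ⟨z, rfl⟩ := primeMk_surjective _ x
  have h₁ : primeCoaction C ∘ₗ primeMk C = (primeMk C).rTensor H ∘ₗ primeCoact k H N := rfl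
  have h₂ : ∀ w : ((H ⊗[k] N) ⊗[k] H) ⊗[k] H, TensorProduct.assoc k (Prime C) H H
      (((primeMk C).rTensor H).rTensor H w) =
      (primeMk C).rTensor (H ⊗[k] H) (TensorProduct.assoc k (H ⊗[k] N) H H w) := by
    intro w
    rw [LinearMap.rTensor_tensor]
    simp
  have h₃ : (primeCoaction C).rTensor H ((primeMk C).rTensor H (primeCoact k H N z)) =
      ((primeMk C).rTensor H).rTensor H ((primeCoact k H N).rTensor H (primeCoact k H N z)) := by
    rw [← LinearMap.rTensor_comp_apply, h₁, LinearMap.rTensor_comp_apply]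
  rw [primeCoaction_mk, h₃, h₂, primeCoact_coassoc]
  exact LinearMap.congr_fun ((LinearMap.rTensor_comp_lTensor ..).trans
    (LinearMap.lTensor_comp_rTensor ..).symm) (primeCoact k H N z)

theorem primeCoaction_counit (C : RightContramodule k H N) (x : Prime C) :
    TensorProduct.rid k (Prime C)
      ((Coalgebra.counit (R := k) (A := H)).lTensor (Prime C) (primeCoaction C x)) = x := by
  obtain ⟨z, rfl⟩ := primeMk_surjective _ x
  have h₁ : ∀ w : (H ⊗[k] N) ⊗[k] H, TensorProduct.rid k (Prime C)
      ((Coalgebra.counit (R := k) (A := H)).lTensor _ ((primeMk C).rTensor H w)) =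
      primeMk C (TensorProduct.rid k (H ⊗[k] N)
        ((Coalgebra.counit (R := k) (A := H)).lTensor _ w)) := by
    intro w
    induction w with
    | zero => simp only [map_zero]
    | add x y hx hy => simp only [map_add, hx, hy]
    | tmul a b =>
      rw [LinearMap.rTensor_tmul, LinearMap.lTensor_tmul, LinearMap.lTensor_tmul,
        TensorProduct.rid_tmul, TensorProduct.rid_tmul, map_smul]
  rw [primeCoaction_mk, h₁, primeCoact_counit]

/-- The right comodule structure `h ⊗ n ↦ (h¹ ⊗ n) ⊗ h²` on `N'`. -/
noncomputable def primeComodule (C : RightContramodule k H N) : RightComodule k H (Prime C) where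
  coact := primeCoaction C
  coassoc := primeCoaction_coassoc C
  counit_coact := primeCoaction_counit C

theorem primeComodule_coact_mk (C : RightContramodule k H N) (z : H ⊗[k] N) :
    (primeComodule C).coact (primeMk C z) = (primeMk C).rTensor H (primeCoact k H N z) := rfl

/-- The action induced on a quotient, given the operators it consists of. -/
def descendAct {E Q : Type*} [AddCommGroup E] [Module k E] [AddCommGroup Q] [Module k Q]
    (p : E →ₗ[k] Q) (hp : Function.Surjective p) (A : H →ₐ[k] Module.End k E)
    (S : H → Module.End k Q) (hS : ∀ h z, S h (p z) = p (A h z)) : H →ₐ[k] Module.End k Q :=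
  AlgHom.ofLinearMap
    { toFun := S
      map_add' := fun g h => LinearMap.ext fun x => by
        obtain ⟨z, rfl⟩ := hp x
        simp [hS]
      map_smul' := fun c h => LinearMap.ext fun x => by
        obtain ⟨z, rfl⟩ := hp x
        simp [hS] }
    (LinearMap.ext fun x => by
      obtain ⟨z, rfl⟩ := hp x
      simp [hS])
    (fun g h => LinearMap.ext fun x => by
      obtain ⟨z, rfl⟩ := hp x
      simp [hS])

theorem descendAct_apply {E Q : Type*} [AddCommGroup E] [Module k E] [AddCommGroup Q] [Module k Q]
    (p : E →ₗ[k] Q) (hp : Function.Surjective p) (A : H →ₐ[k] Module.End k E)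
    (S : H → Module.End k Q) (hS : ∀ h z, S h (p z) = p (A h z)) (h : H) :
    descendAct p hp A S hS h = S h := rfl

variable [BijectiveAntipode k H]

theorem twistMH_rTensor {M M' : Type*} [AddCommGroup M] [Module k M] [AddCommGroup M']
    [Module k M'] (act : H →ₐ[k] Module.End k M) (act' : H →ₐ[k] Module.End k M') (n : ℤ)
    (g : M →ₗ[k] M') (hg : ∀ h m, g (act h m) = act' h (g m)) (h : H) (x : M ⊗[k] H) :
    g.rTensor H (twistMH act n h x) = twistMH act' n h (g.rTensor H x) :=
  twist_congr (TensorProduct.mapBilinear (RingHom.id k) M H M H)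
    (TensorProduct.mapBilinear (RingHom.id k) M' H M' H) act act' _ _
    (g.rTensor H ∘ₗ LinearMap.applyₗ x) (LinearMap.applyₗ (g.rTensor H x))
    (fun a b => by
      simp only [LinearMap.comp_apply, LinearMap.applyₗ_apply_apply]
      induction x with
      | zero => simp
      | add x y hx hy => simp only [map_add, hx, hy]
      | tmul x y => simp [hg]) h

end PrimeStructure

/-! ### The Yetter–Drinfeld module structure on N'. -/

section PrimeYD

variable {k : Type u} {H : Type v} [Field k] [Ring H] [HopfAlgebra k H] [BijectiveAntipode k H]
  {N : Type (max v w)} [AddCommGroup N] [Module k N]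

theorem tensorAct_apply {M : Type w} [AddCommGroup M] [Module k M] (act : H →ₐ[k] Module.End k M)
    {n : ℤ} (hn : Even n) (h : H) : tensorAct act hn h = twistHM act (n + 1) h := rfl

/-- Both maps defining the cokernel are H-equivariant for the twisted actions: `evalMap` always, and
Id ⊗ α by the contramodule law. Taking N in universe `max v w` puts Hom(H, N) in the same universe,
so α is covered by `twistHM_lTensor`. -/
theorem primeMk_twistHM_contra (C : RightContramodule k H N) {act : H →ₐ[k] Module.End k N} {n : ℤ}
    (hn : Even n) (hα : ∀ h f, C.contra (twistHom act n h f) = act h (C.contra f)) (h : H)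
    (z : H ⊗[k] (H →ₗ[k] N)) :
    primeMk C (twistHM act (n + 1) h (C.contra.lTensor H z)) =
      primeMk C (twistHM act (n + 1) h (evalMap k H N z)) := by
  rw [← evalMap_twistHM hn, ← primeMk_contra,
    twistHM_lTensor.{u, v, max v w} (homAct act hn) act (n + 1) C.contra hα]

/-- The map `x ⊗ m ↦ ∑ h³ x S^{n+1}(h¹) ⊗ h² m` on `N'`, for even `n`. -/
noncomputable def primeSmul (C : RightContramodule k H N) {act : H →ₐ[k] Module.End k N} {n : ℤ}
    (hn : Even n) (hα : ∀ h f, C.contra (twistHom act n h f) = act h (C.contra f)) (h : H) :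
    Module.End k (Prime C) :=
  primeLift C (primeMk C ∘ₗ twistHM act (n + 1) h) (primeMk_twistHM_contra C hn hα h)

theorem primeSmul_mk (C : RightContramodule k H N) {act : H →ₐ[k] Module.End k N} {n : ℤ}
    (hn : Even n) (hα : ∀ h f, C.contra (twistHom act n h f) = act h (C.contra f)) (h : H)
    (z : H ⊗[k] N) :
    primeSmul C hn hα h (primeMk C z) = primeMk C (twistHM act (n + 1) h z) := rfl

/-- The action `h · (x ⊗ m) = ∑ h³ x S^{n+1}(h¹) ⊗ h² m` on `N'`, for even `n`. -/
noncomputable def primeAct (C : RightContramodule k H N) {act : H →ₐ[k] Module.End k N} {n : ℤ}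
    (hn : Even n) (hα : ∀ h f, C.contra (twistHom act n h f) = act h (C.contra f)) :
    H →ₐ[k] Module.End k (Prime C) :=
  descendAct (primeMk C) (primeMk_surjective C) (tensorAct act hn) (primeSmul C hn hα)
    (fun h z => by rw [tensorAct_apply, primeSmul_mk])

theorem primeAct_mk (C : RightContramodule k H N) {act : H →ₐ[k] Module.End k N} {n : ℤ}
    (hn : Even n) (hα : ∀ h f, C.contra (twistHom act n h f) = act h (C.contra f)) (h : H)
    (z : H ⊗[k] N) :
    primeAct C hn hα h (primeMk C z) = primeMk C (twistHM act (n + 1) h z) := by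
  rw [primeAct, descendAct_apply, primeSmul_mk]

theorem primeComodule_coact_primeAct (C : RightContramodule k H N) {act : H →ₐ[k] Module.End k N}
    {n : ℤ} (hn : Even n) (hα : ∀ h f, C.contra (twistHom act n h f) = act h (C.contra f)) (h : H)
    (x : Prime C) : (primeComodule C).coact (primeAct C hn hα h x) =
      twistMH (primeAct C hn hα) (n + 1) h ((primeComodule C).coact x) := by
  obtain ⟨z, rfl⟩ := primeMk_surjective _ x
  rw [primeAct_mk, primeComodule_coact_mk, primeComodule_coact_mk, primeCoact_twistHM hn,
    twistMH_rTensor (tensorAct act hn) (primeAct C hn hα) _ _ (fun _ _ => rfl)]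

end PrimeYD

/-! ### The contraaction and the action on M̂. -/

section HatStructure

variable {k : Type u} {H : Type v} [Field k] [Ring H] [HopfAlgebra k H]
  {M : Type w} [AddCommGroup M] [Module k M]

theorem hatContra_eq_diagonal (C : RightComodule k H M) (θ : H →ₗ[k] hat C) :
    hatContra C θ = diagonal ((hat C).subtype ∘ₗ θ) := rfl

theorem hatContra_apply (C : RightComodule k H M) (θ : H →ₗ[k] hat C) (h : H) :
    hatContra C θ h = TensorProduct.lift ((hat C).subtype ∘ₗ θ) (Coalgebra.comul h) := rfl

/-- Each θ_a is colinear, so the coaction sends θ_{h¹}(h²) to θ_{h¹}(h²) ⊗ h³; coassociativity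
regroups the first two legs. -/
theorem hatContra_mem (C : RightComodule k H M) (θ : H →ₗ[k] hat C) : hatContra C θ ∈ hat C := by
  intro h
  have h₁ : ∀ t : H ⊗[k] H, C.coact (TensorProduct.lift ((hat C).subtype ∘ₗ θ) t) =
      (TensorProduct.lift ((hat C).subtype ∘ₗ θ)).rTensor H
        ((TensorProduct.assoc k H H H).symm ((Coalgebra.comul (R := k)).lTensor H t)) := by
    intro t
    induction t with
    | zero => simp
    | add x y hx hy => simp only [map_add, hx, hy]
    | tmul a b =>
      refine ((θ a).2 b).trans ?_
      rw [LinearMap.lTensor_tmul]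
      generalize Coalgebra.comul (R := k) b = t
      induction t with
      | zero => simp
      | add x y hx hy => simp only [map_add, TensorProduct.tmul_add, hx, hy]
      | tmul x y => simp
  rw [hatContra_apply, h₁, Coalgebra.coassoc_symm_apply, ← LinearMap.rTensor_comp_apply]
  rfl

/-- The contraaction `αθ(h) = ∑ θ_{h¹}(h²)` on `M̂`. -/
noncomputable def hatContraaction (C : RightComodule k H M) : (H →ₗ[k] hat C) →ₗ[k] hat C :=
  LinearMap.codRestrict (hat C) (diagonal ∘ₗ LinearMap.compRight k (hat C).subtype)
    (hatContra_mem C)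

theorem coe_hatContraaction (C : RightComodule k H M) (θ : H →ₗ[k] hat C) :
    (hatContraaction C θ : H →ₗ[k] M) = hatContra C θ := rfl

/-- The contramodule structure on `M̂`. -/
noncomputable def hatContramodule (C : RightComodule k H M) : RightContramodule k H (hat C) where
  contra := hatContraaction C
  -- Both sides evaluate at h to f(h¹ ⊗ h²)(h³), bracketed differently.
  contra_assoc f := by
    apply Subtype.ext
    rw [coe_hatContraaction, coe_hatContraaction]
    ext h
    have h₁ : ∀ t : H ⊗[k] H,
        TensorProduct.lift ((hat C).subtype ∘ₗ hatContraaction C ∘ₗ TensorProduct.curry f) t =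
        TensorProduct.lift ((hat C).subtype ∘ₗ f)
          ((TensorProduct.assoc k H H H).symm ((Coalgebra.comul (R := k)).lTensor H t)) := by
      intro t
      induction t with
      | zero => simp
      | add x y hx hy => simp only [map_add, hx, hy]
      | tmul a b =>
        simp only [TensorProduct.lift.tmul, LinearMap.comp_apply, Submodule.subtype_apply,
          coe_hatContraaction, hatContra_apply, LinearMap.lTensor_tmul]
        generalize Coalgebra.comul (R := k) b = t
        induction t with
        | zero => simp
        | add x y hx hy => simp only [map_add, TensorProduct.tmul_add, hx, hy]
        | tmul x y => simp
    have h₂ : ∀ t : H ⊗[k] H,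
        TensorProduct.lift ((hat C).subtype ∘ₗ f ∘ₗ Coalgebra.comul) t =
        TensorProduct.lift ((hat C).subtype ∘ₗ f) ((Coalgebra.comul (R := k)).rTensor H t) := by
      intro t
      induction t with
      | zero => simp
      | add x y hx hy => simp only [map_add, hx, hy]
      | tmul a b => simp
    rw [hatContra_apply, hatContra_apply, h₁, h₂, Coalgebra.coassoc_symm_apply]
  contra_counit φ := by
    apply Subtype.ext
    rw [coe_hatContraaction]
    ext h
    have h₁ : ∀ t : H ⊗[k] H, TensorProduct.lift ((hat C).subtype ∘ₗ
        (Coalgebra.counit (R := k) (A := H)).smulRight φ) t =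
        (φ : H →ₗ[k] M) (TensorProduct.lid k H
          ((Coalgebra.counit (R := k) (A := H)).rTensor H t)) := by
      intro t
      induction t with
      | zero => simp
      | add x y hx hy => simp only [map_add, hx, hy]
      | tmul a b => simp
    rw [hatContra_apply, h₁]
    simp

variable [BijectiveAntipode k H]

/-- The action `h · f = ∑ h² f(S(h³) - S^n(h¹))` on `M̂`. -/
noncomputable def hatAct (C : RightComodule k H M) {act : H →ₐ[k] Module.End k M} {n : ℤ}
    (hn : Even n) (hρ : ∀ h m, C.coact (act h m) = twistMH act (n + 1) h (C.coact m)) :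
    H →ₐ[k] Module.End k (hat C) :=
  AlgHom.ofLinearMap
    { toFun := fun h => (twistHom act n h).restrict fun _ hf => twistHom_mem_hat hn hρ h hf
      map_add' := fun g h => by ext; simp
      map_smul' := fun c h => by ext; simp }
    (by
      ext f x
      exact LinearMap.congr_fun (LinearMap.congr_fun (map_one (homAct act hn)) _) x)
    (fun g h => by
      ext f x
      exact LinearMap.congr_fun (LinearMap.congr_fun (map_mul (homAct act hn) g h) _) x)

theorem coe_hatAct (C : RightComodule k H M) {act : H →ₐ[k] Module.End k M} {n : ℤ}
    (hn : Even n) (hρ : ∀ h m, C.coact (act h m) = twistMH act (n + 1) h (C.coact m)) (h : H)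
    (f : hat C) : (hatAct C hn hρ h f : H →ₗ[k] M) = twistHom act n h f := rfl

end HatStructure

/-! ### Compatibility of action and contraaction on M̂. -/

section HatYD

variable {k : Type u} {H : Type v} [Field k] [Ring H] [HopfAlgebra k H] [BijectiveAntipode k H]
  {M : Type (max v w)} [AddCommGroup M] [Module k M]

theorem hatContraaction_twistHom (C : RightComodule k H M) {act : H →ₐ[k] Module.End k M} {n : ℤ}
    (hn : Even n) (hρ : ∀ h m, C.coact (act h m) = twistMH act (n + 1) h (C.coact m)) (h : H)
    (θ : H →ₗ[k] hat C) : hatContraaction C (twistHom (hatAct C hn hρ) n h θ) =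
      hatAct C hn hρ h (hatContraaction C θ) := by
  apply Subtype.ext
  rw [coe_hatAct, coe_hatContraaction, coe_hatContraaction, hatContra_eq_diagonal,
    hatContra_eq_diagonal, ← diagonal_twistHom hn,
    twistHom_comp.{u, v, max v w} (hatAct C hn hρ) (homAct act hn) n (hat C).subtype
      (fun _ _ => rfl)]

end HatYD

/-! ### Colinearity and the contraaction across the tensor-hom correspondence. -/

section Adjunction

variable {k : Type u} {H : Type v} [Field k] [Ring H] [HopfAlgebra k H]
  {M N : Type w} [AddCommGroup M] [Module k M] [AddCommGroup N] [Module k N]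

/-- The map `N → Hom(H, M)` corresponding to a map `N' → M`. -/
noncomputable def primeCurry (D : RightContramodule k H N) (F : Prime D →ₗ[k] M) :
    N →ₗ[k] (H →ₗ[k] M) := (TensorProduct.curry (F ∘ₗ primeMk D)).flip

theorem primeCurry_apply (D : RightContramodule k H N) (F : Prime D →ₗ[k] M) (n : N) (h : H) :
    primeCurry D F n h = F (primeMk D (h ⊗ₜ n)) := rfl

theorem lift_primeCurry (D : RightContramodule k H N) (F : Prime D →ₗ[k] M) (z : H ⊗[k] N) :
    TensorProduct.lift (primeCurry D F).flip z = F (primeMk D z) := by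
  induction z with
  | zero => simp
  | add x y hx hy => simp only [map_add, hx, hy]
  | tmul x y => rfl

/-- A map of comodules `N' → M` corresponds to a map `N → M̂`. -/
theorem primeCurry_mem (C : RightComodule k H M) (D : RightContramodule k H N)
    (F : Prime D →ₗ[k] M) (hF : ∀ z, C.coact (F (primeMk D z)) =
      F.rTensor H ((primeMk D).rTensor H (primeCoact k H N z))) (n : N) :
    primeCurry D F n ∈ hat C := by
  intro h
  rw [primeCurry_apply, hF, primeCoact_tmul]
  generalize Coalgebra.comul (R := k) h = t
  induction t with
  | zero => simp only [map_zero]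
  | add x y hx hy => simp only [map_add, hx, hy]
  | tmul x y =>
    simp only [insertMid, LinearMap.rTensor_tmul, LinearMap.flip_apply, TensorProduct.mk_apply,
      primeCurry_apply]

/-- The relation h² ⊗ f(h¹) is matched with the contraaction of M̂: both give G(f(h¹))(h²). Hence F
descends to N' exactly when G commutes with contraactions. -/
theorem lift_flip_evalMap (G : N →ₗ[k] (H →ₗ[k] M)) (h : H) (f : H →ₗ[k] N) :
    TensorProduct.lift G.flip (evalMap k H N (h ⊗ₜ f)) = diagonal (G ∘ₗ f) h := by
  rw [evalMap_tmul, diagonal_apply]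
  generalize Coalgebra.comul (R := k) h = t
  induction t with
  | zero => simp
  | add x y hx hy => simp only [map_add, hx, hy]
  | tmul x y => simp

theorem primeCurry_contra (D : RightContramodule k H N) (F : Prime D →ₗ[k] M) (f : H →ₗ[k] N) :
    primeCurry D F (D.contra f) = diagonal (primeCurry D F ∘ₗ f) := by
  ext h
  rw [← lift_flip_evalMap, lift_primeCurry, ← primeMk_contra]
  rfl

/-- The map `N' → M` corresponding to a map `N → Hom(H, M)`. -/
noncomputable def primeUncurry (D : RightContramodule k H N) (G : N →ₗ[k] (H →ₗ[k] M))
    (hG : ∀ f, G (D.contra f) = diagonal (G ∘ₗ f)) : Prime D →ₗ[k] M :=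
  primeLift D (TensorProduct.lift G.flip) (fun z => by
    induction z with
    | zero => simp
    | add x y hx hy => simp only [map_add, hx, hy]
    | tmul x f =>
      rw [lift_flip_evalMap, ← hG]
      rfl)

theorem primeUncurry_mk (D : RightContramodule k H N) (G : N →ₗ[k] (H →ₗ[k] M))
    (hG : ∀ f, G (D.contra f) = diagonal (G ∘ₗ f)) (z : H ⊗[k] N) :
    primeUncurry D G hG (primeMk D z) = TensorProduct.lift G.flip z := rfl

theorem primeUncurry_coact (C : RightComodule k H M) (D : RightContramodule k H N)
    (G : N →ₗ[k] (H →ₗ[k] M)) (hG : ∀ f, G (D.contra f) = diagonal (G ∘ₗ f))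
    (hm : ∀ n, G n ∈ hat C) (z : H ⊗[k] N) :
    C.coact (primeUncurry D G hG (primeMk D z)) =
      (primeUncurry D G hG).rTensor H ((primeMk D).rTensor H (primeCoact k H N z)) := by
  rw [primeUncurry_mk]
  induction z with
  | zero => simp only [map_zero]
  | add x y hx hy => simp only [map_add, hx, hy]
  | tmul h n =>
    rw [TensorProduct.lift.tmul, LinearMap.flip_apply, hm, primeCoact_tmul]
    generalize Coalgebra.comul (R := k) h = t
    induction t with
    | zero => simp only [map_zero]
    | add x y hx hy => simp only [map_add, hx, hy]
    | tmul x y =>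
      simp only [insertMid, LinearMap.rTensor_tmul, LinearMap.flip_apply, TensorProduct.mk_apply,
        primeUncurry_mk, TensorProduct.lift.tmul]

end Adjunction

/-! ### Specialization to n = -2i. -/

section Functors

variable {k : Type u} {H : Type v} [Field k] [Ring H] [HopfAlgebra k H] [BijectiveAntipode k H]
  {i : ℤ}

theorem even_neg_two_mul (i : ℤ) : Even (-2 * i) := ⟨-i, by ring⟩

theorem YDModule.coact_act' {M : Type w} [AddCommGroup M] [Module k M]
    (s : YDModule k H (i - 1) M) (h : H) (m : M) :
    s.coact (s.act h m) = twistMH s.act (-2 * i + 1) h (s.coact m) := by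
  rw [s.coact_act, show -1 - 2 * (i - 1) = -2 * i + 1 by ring]

theorem YDContramodule.contra_act' {N : Type w} [AddCommGroup N] [Module k N]
    (s : YDContramodule k H (i + 1) N) (h : H) (f : H →ₗ[k] N) :
    s.contra (twistHom s.act (-2 * i) h f) = s.act h (s.contra f) := by
  rw [← s.contra_act, show 2 - 2 * (i + 1) = -2 * i by ring]

/-- The `YD_{i+1}`-contramodule `M̂`. -/
noncomputable def hatYD (M : YDModCat.{u, v, max v w} k H (i - 1)) :
    YDContramodule k H (i + 1) (hat M.str.toRightComodule) where
  toRightContramodule := hatContramodule M.str.toRightComodule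
  act := hatAct M.str.toRightComodule (even_neg_two_mul i) M.str.coact_act'
  contra_act h f := by
    rw [show 2 - 2 * (i + 1) = -2 * i by ring]
    exact hatContraaction_twistHom.{u, v, w} _ _ _ h f

/-- The `YD_{i-1}`-module `N'`. -/
noncomputable def primeYD (N : YDContraCat.{u, v, max v w} k H (i + 1)) :
    YDModule k H (i - 1) (Prime N.str.toRightContramodule) where
  toRightComodule := primeComodule N.str.toRightContramodule
  act := primeAct.{u, v, w} N.str.toRightContramodule (even_neg_two_mul i) N.str.contra_act'
  coact_act h x := by
    rw [show -1 - 2 * (i - 1) = -2 * i + 1 by ring]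
    exact primeComodule_coact_primeAct.{u, v, w} _ _ _ h x

end Functors

/-! ### The adjunction between the two functors. -/

section AdjunctionFunctors

variable {k : Type u} {H : Type v} [Field k] [Ring H] [HopfAlgebra k H] [BijectiveAntipode k H]
  {i : ℤ}

theorem hatYD_act (M : YDModCat.{u, v, max v w} k H (i - 1)) (h : H)
    (f : hat M.str.toRightComodule) :
    (((hatYD.{u, v, w} M).act h f : hat M.str.toRightComodule) : H →ₗ[k] M.carrier) =
      twistHom M.str.act (-2 * i) h f := rfl

theorem hatYD_contra (M : YDModCat.{u, v, max v w} k H (i - 1))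
    (θ : H →ₗ[k] hat M.str.toRightComodule) :
    (((hatYD.{u, v, w} M).contra θ : hat M.str.toRightComodule) : H →ₗ[k] M.carrier) =
      hatContra M.str.toRightComodule θ := rfl

theorem primeYD_act (N : YDContraCat.{u, v, max v w} k H (i + 1)) (h : H) (x : H ⊗[k] N.carrier) :
    (primeYD.{u, v, w} N).act h (primeMk N.str.toRightContramodule x) =
      primeMk N.str.toRightContramodule (twistHM N.str.act (1 - 2 * i) h x) := by
  rw [show 1 - 2 * i = -2 * i + 1 by ring]
  exact primeAct_mk.{u, v, w} _ _ _ h x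

theorem primeYD_coact (N : YDContraCat.{u, v, max v w} k H (i + 1)) (x : H ⊗[k] N.carrier) :
    (primeYD.{u, v, w} N).coact (primeMk N.str.toRightContramodule x) =
      (primeMk N.str.toRightContramodule).rTensor H (primeCoact k H N.carrier x) := rfl

variable (N : YDContraCat.{u, v, max v w} k H (i + 1)) (M : YDModCat.{u, v, max v w} k H (i - 1))

/-- The morphism `N → M̂` corresponding to a morphism `N' → M`. -/
noncomputable def homCurry
    (F : YDModCat.Hom ⟨Prime N.str.toRightContramodule, primeYD.{u, v, w} N⟩ M) :
    YDContraCat.Hom N ⟨hat M.str.toRightComodule, hatYD.{u, v, w} M⟩ where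
  -- Colinearity of F is what places the curried map in M̂.
  hom := LinearMap.codRestrict _ (primeCurry N.str.toRightContramodule F.hom)
    (primeCurry_mem _ _ _ fun z => (F.map_coact _).trans (congrArg _ (primeYD_coact N z)))
  map_act h n := by
    apply Subtype.ext
    refine (lift_twistHM_iff M.str.act N.str.act (even_neg_two_mul i)
      (primeCurry N.str.toRightContramodule F.hom)).1 (fun h z => ?_) h n
    rw [lift_primeCurry, lift_primeCurry, show -2 * i + 1 = 1 - 2 * i by ring, ← primeYD_act,
      F.map_act]
  map_contra f := Subtype.ext (primeCurry_contra _ F.hom f)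

/-- The morphism `N' → M` corresponding to a morphism `N → M̂`. -/
noncomputable def homUncurry
    (G : YDContraCat.Hom N ⟨hat M.str.toRightComodule, hatYD.{u, v, w} M⟩) :
    YDModCat.Hom ⟨Prime N.str.toRightContramodule, primeYD.{u, v, w} N⟩ M where
  hom := primeUncurry N.str.toRightContramodule ((hat M.str.toRightComodule).subtype ∘ₗ G.hom)
    (fun f => congrArg Subtype.val (G.map_contra f))
  map_act h x := by
    obtain ⟨z, rfl⟩ := primeMk_surjective _ x
    have h₁ := (lift_twistHM_iff M.str.act N.str.act (even_neg_two_mul i)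
      ((hat M.str.toRightComodule).subtype ∘ₗ G.hom)).2
      (fun h n => congrArg Subtype.val (G.map_act h n)) h z
    rw [show -2 * i + 1 = 1 - 2 * i by ring] at h₁
    exact (congrArg _ (primeYD_act N h z)).trans h₁
  map_coact x := by
    obtain ⟨z, rfl⟩ := primeMk_surjective _ x
    exact primeUncurry_coact _ _ _ _ (fun n => (G.hom n).2) z

/-- The bijection `Hom(N', M) ≃ Hom(N, M̂)`. -/
noncomputable def primeHatHomEquiv :
    YDModCat.Hom ⟨Prime N.str.toRightContramodule, primeYD.{u, v, w} N⟩ M ≃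
      YDContraCat.Hom N ⟨hat M.str.toRightComodule, hatYD.{u, v, w} M⟩ where
  toFun := homCurry.{u, v, w} N M
  invFun := homUncurry.{u, v, w} N M
  left_inv F := by
    apply YDModCat.Hom.ext
    refine LinearMap.ext fun x => ?_
    obtain ⟨z, rfl⟩ := primeMk_surjective _ x
    exact lift_primeCurry _ _ z
  right_inv G := rfl

/-- The functor `N ↦ N'` is left adjoint to `M ↦ M̂`. -/
noncomputable def primeHatAdjunction :
    primeFunctor.{u, v, w} (k := k) (H := H) (i := i) primeYD.{u, v, w} primeYD_act primeYD_coact ⊣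
      hatFunctor.{u, v, w} hatYD.{u, v, w} hatYD_act hatYD_contra :=
  Adjunction.mkOfHomEquiv
    { homEquiv := fun N M => primeHatHomEquiv.{u, v, w} N M
      homEquiv_naturality_left_symm := fun _ _ => (Equiv.symm_apply_eq _).2 rfl
      homEquiv_naturality_right := fun _ _ => rfl }

end AdjunctionFunctors

end HopfYD

theorem mainTheorem9 (k : Type u) (H : Type v) [Field k] [CharZero k] [Ring H]
    [HopfAlgebra k H] [HopfYD.BijectiveAntipode k H] (i : ℤ) :
    ∃ (s : ∀ M : HopfYD.YDModCat.{u, v, max v w} k H (i - 1),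
        HopfYD.YDContramodule k H (i + 1) (HopfYD.hat M.str.toRightComodule))
      (hs_act : ∀ M h f,
        (((s M).act h f : HopfYD.hat M.str.toRightComodule) : H →ₗ[k] M.carrier) =
          HopfYD.twistHom M.str.act (-2 * i) h f)
      (hs_contra : ∀ M θ,
        (((s M).contra θ : HopfYD.hat M.str.toRightComodule) : H →ₗ[k] M.carrier) =
          HopfYD.hatContra M.str.toRightComodule θ)
      (t : ∀ N : HopfYD.YDContraCat.{u, v, max v w} k H (i + 1),
        HopfYD.YDModule k H (i - 1) (HopfYD.Prime N.str.toRightContramodule))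
      (ht_act : ∀ N h x,
        (t N).act h (HopfYD.primeMk N.str.toRightContramodule x) =
          HopfYD.primeMk N.str.toRightContramodule
            (HopfYD.twistHM N.str.act (1 - 2 * i) h x))
      (ht_coact : ∀ N x,
        (t N).coact (HopfYD.primeMk N.str.toRightContramodule x) =
          (HopfYD.primeMk N.str.toRightContramodule).rTensor H
            (HopfYD.primeCoact k H N.carrier x)),
      Nonempty (HopfYD.primeFunctor.{u, v, w} t ht_act ht_coact ⊣
        HopfYD.hatFunctor.{u, v, w} s hs_act hs_contra) :=
  ⟨HopfYD.hatYD.{u, v, w}, HopfYD.hatYD_act, HopfYD.hatYD_contra, HopfYD.primeYD.{u, v, w},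
    HopfYD.primeYD_act, HopfYD.primeYD_coact, ⟨HopfYD.primeHatAdjunction⟩⟩
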